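/- Let $k$ be an algebraically closed field of characteristic zero and let $A$ be a Hopf algebra over $k$, with comultiplication $\Delta$, counit $\varepsilon$ and antipode $S$. Assume that $A$ is cosemisimple (the category of right $A$-comodules is semisimple, i.e. every subcomodule of a right $A$-comodule is a direct summand as a comodule) and that $S^4=\mathrm{id}_A$. Then $$\mathrm{cd}(A)=\mathrm{cd}_{\mathrm{GS}}(A).$$ Here $$\mathrm{cd}(A)=\sup\{n : H^n(A,M)\neq 0 \text{ for some } A\text{-bimodule } M\}\in\mathbb N\cup\{\infty\}$$ is the Hochschild cohomological dimension of $A$, where $H^n(A,M)=\mathrm{Ext}^n_{A\otimes_k A^{\mathrm{op}}}(A,M)$ is Hochschild cohomology; and $$\mathrm{cd}_{\mathrm{GS}}(A)=\sup\{n : \mathrm{Ext}^n_{\mathcal{YD}_A^A}(k,V)\neq 0 \text{ for some } V\in\mathcal{YD}_A^A\}\in\mathbb N\cup\{\infty\}$$ is the Gerstenhaber-Schack cohomological dimension of $A$, where $\mathcal{YD}_A^A$ is the abelian category of right-right Yetter-Drinfeld modules over $A$: its objects are the right $A$-modules and right $A$-comodules $V$ such that $$(v\cdot a)_{(0)}\otimes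 (v\cdot a)_{(1)} = v_{(0)}\cdot a_{(2)}\otimes S(a_{(1)})\,v_{(1)}\,a_{(3)}\qquad (v\in V,\ a\in A),$$ its morphisms are the $A$-linear and $A$-colinear maps, and $k$ denotes the trivial Yetter-Drinfeld module, with $x\cdot a=\varepsilon(a)x$ and coaction $x\mapsto x\otimes 1$. -/

import Mathlib

open CategoryTheory Limits TensorProduct MulOpposite

universe u

noncomputable section

namespace HopfCD

/-! ### Right comodules and cosemisimplicity -/

/-- A right comodule structure on the vector space `V` over the coalgebra `A`:
a coassociative and counital linear map `V → V ⊗ A`. -/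
class RightComodule (k : Type*) (A : Type*) (V : Type*) [Field k] [AddCommGroup A] [Module k A]
    [Coalgebra k A] [AddCommGroup V] [Module k V] where
  /-- The coaction `v ↦ v₍₀₎ ⊗ v₍₁₎`. -/
  coact : V →ₗ[k] V ⊗[k] A
  /-- `v₍₀₎₍₀₎ ⊗ (v₍₀₎₍₁₎ ⊗ v₍₁₎) = v₍₀₎ ⊗ (v₍₁₎₍₁₎ ⊗ v₍₁₎₍₂₎)`. -/
  coassoc : ∀ x : V, TensorProduct.assoc k V A A (coact.rTensor A (coact x)) =
    (Coalgebra.comul (R := k) (A := A)).lTensor V (coact x)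
  /-- `ε(v₍₁₎) v₍₀₎ = v`. -/
  counit : ∀ x : V, TensorProduct.rid k V
    ((Coalgebra.counit (R := k) (A := A)).lTensor V (coact x)) = x

/-- A linear subspace `W` of a right comodule `V` is a subcomodule if the coaction maps `W` into
(the image in `V ⊗ A` of) `W ⊗ A`. -/
def IsSubcomodule (k : Type*) (A : Type*) {V : Type*} [Field k] [AddCommGroup A] [Module k A]
    [Coalgebra k A] [AddCommGroup V] [Module k V] [RightComodule k A V]
    (W : Submodule k V) : Prop :=
  ∀ w ∈ W, RightComodule.coact (A := A) w ∈ LinearMap.range (W.subtype.rTensor A)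

/-- `A` is cosemisimple: its category of right comodules is semisimple, i.e. every subcomodule
of a right comodule is a direct summand, as a comodule. -/
def IsCosemisimple (k A : Type u) [Field k] [AddCommGroup A] [Module k A] [Coalgebra k A] :
    Prop :=
  ∀ (V : Type u) [AddCommGroup V] [Module k V] [RightComodule k A V] (W : Submodule k V),
    IsSubcomodule k A W → ∃ W' : Submodule k V, IsSubcomodule k A W' ∧ IsCompl W W'

/-! ### Hochschild cohomology -/

section Hochschild

variable (k A : Type u) [Field k] [Ring A] [Algebra k A]

/-- The algebra `A` as an `A`-bimodule, i.e. as a left module over the enveloping algebra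
`A ⊗ Aᵐᵒᵖ`, where `(a ⊗ b) • x = a x b`. -/
def regularBimodule : ModuleCat.{u} (A ⊗[k] Aᵐᵒᵖ) :=
  letI := instModuleTensorProductMop k A
  ModuleCat.of (A ⊗[k] Aᵐᵒᵖ) A

/-- Hochschild cohomology `Hⁿ(A, M)`, for `A`-bimodules `M` (on which the two actions of `k`
agree): the group `Extⁿ(A, M)` in the category of `A`-bimodules. -/
def HochschildCohomology (M : ModuleCat.{u} (A ⊗[k] Aᵐᵒᵖ)) (n : ℕ) : Type u :=
  Abelian.Ext.{u} (regularBimodule k A) M n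

instance (M : ModuleCat.{u} (A ⊗[k] Aᵐᵒᵖ)) (n : ℕ) : AddCommGroup (HochschildCohomology k A M n) :=
  inferInstanceAs (AddCommGroup (Abelian.Ext.{u} (regularBimodule k A) M n))

/-- The Hochschild cohomological dimension of the algebra `A`: the supremum of the `n` with
`Hⁿ(A, M) ≠ 0` for some bimodule `M`. -/
def cd : ℕ∞ :=
  sSup {d : ℕ∞ | ∃ n : ℕ, d = n ∧
    ∃ M : ModuleCat.{u} (A ⊗[k] Aᵐᵒᵖ), Nontrivial (HochschildCohomology k A M n)}

end Hochschild

/-! ### Yetter-Drinfeld modules -/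

section YD

variable (k : Type*) (A : Type*) [Field k] [Ring A] [HopfAlgebra k A]

/-- Right multiplication `v ↦ v · a` on a right `A`-module. -/
def ract (V : Type*) [AddCommGroup V] [Module k V] [Module Aᵐᵒᵖ V] [IsScalarTower k Aᵐᵒᵖ V] :
    A →ₗ[k] Module.End k V :=
  (Algebra.lsmul k k V : Aᵐᵒᵖ →ₐ[k] Module.End k V).toLinearMap ∘ₗ
    (opLinearEquiv k : A ≃ₗ[k] Aᵐᵒᵖ).toLinearMap

/-- The operators `v ⊗ x ↦ (v · b) ⊗ S(a) x c` on `V ⊗ A`, for `a ⊗ (b ⊗ c)` in `A ⊗ (A ⊗ A)`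
(see `twist_tmul`). -/
def twist (V : Type*) [AddCommGroup V] [Module k V] [Module Aᵐᵒᵖ V] [IsScalarTower k Aᵐᵒᵖ V] :
    A ⊗[k] (A ⊗[k] A) →ₗ[k] Module.End k (V ⊗[k] A) :=
  TensorProduct.homTensorHomMap (RingHom.id k) V A V A ∘ₗ
    TensorProduct.map (ract k A V)
      ((AlgHom.mulLeftRight k A).toLinearMap ∘ₗ
        TensorProduct.map (HopfAlgebra.antipode k)
          (opLinearEquiv k : A ≃ₗ[k] Aᵐᵒᵖ).toLinearMap) ∘ₗ
    (TensorProduct.leftComm k A A A).toLinearMap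

variable {k A} in
@[simp]
theorem twist_tmul {V : Type*} [AddCommGroup V] [Module k V] [Module Aᵐᵒᵖ V]
    [IsScalarTower k Aᵐᵒᵖ V] (a b c x : A) (v : V) :
    twist k A V (a ⊗ₜ (b ⊗ₜ c)) (v ⊗ₜ x) =
      (op b • v) ⊗ₜ (HopfAlgebra.antipode k a * x * c) := by
  simp [twist, ract]

/-- A right-right Yetter-Drinfeld module over the Hopf algebra `A`: a right `A`-module and right
`A`-comodule `V` with
`(v · a)₍₀₎ ⊗ (v · a)₍₁₎ = v₍₀₎ · a₍₂₎ ⊗ S(a₍₁₎) v₍₁₎ a₍₃₎`. -/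
class YetterDrinfeld (V : Type*) [AddCommGroup V] [Module k V] [Module Aᵐᵒᵖ V]
    [IsScalarTower k Aᵐᵒᵖ V] extends RightComodule k A V where
  coact_smul : ∀ (v : V) (a : A), coact (op a • v) =
    twist k A V ((Coalgebra.comul (R := k) (A := A)).lTensor A (Coalgebra.comul a)) (coact v)

/-- The coaction of a Yetter-Drinfeld module, with explicit arguments. -/
abbrev coact (V : Type*) [AddCommGroup V] [Module k V] [Module Aᵐᵒᵖ V]
    [IsScalarTower k Aᵐᵒᵖ V] [YetterDrinfeld k A V] : V →ₗ[k] V ⊗[k] A :=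
  RightComodule.coact (A := A)

/-- The map `f ⊗ id_A`, for an `A`-linear map `f`. -/
abbrev tens {V W : Type*} [AddCommGroup V] [Module k V] [Module Aᵐᵒᵖ V]
    [IsScalarTower k Aᵐᵒᵖ V] [AddCommGroup W] [Module k W] [Module Aᵐᵒᵖ W]
    [IsScalarTower k Aᵐᵒᵖ W] (f : V →ₗ[Aᵐᵒᵖ] W) : V ⊗[k] A →ₗ[k] W ⊗[k] A :=
  (f.restrictScalars k).rTensor A

section Tensor

variable {k A}
variable {V W : Type*} [AddCommGroup V] [Module k V] [AddCommGroup W] [Module k W]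

theorem assoc_rTensor (f : V →ₗ[k] W) (z : (V ⊗[k] A) ⊗[k] A) :
    TensorProduct.assoc k W A A ((f.rTensor A).rTensor A z) =
      f.rTensor (A ⊗[k] A) (TensorProduct.assoc k V A A z) := by
  induction z with
  | zero => simp
  | add x y hx hy => simp only [map_add, hx, hy]
  | tmul v x =>
    induction v with
    | zero => simp
    | add x y hx hy => simp only [map_add, add_tmul, hx, hy]
    | tmul v y => simp

theorem rid_lTensor (f : V →ₗ[k] W) (g : A →ₗ[k] k) (z : V ⊗[k] A) :
    TensorProduct.rid k W (g.lTensor W (f.rTensor A z)) =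
      f (TensorProduct.rid k V (g.lTensor V z)) := by
  induction z with
  | zero => simp
  | add x y hx hy => simp only [map_add, hx, hy]
  | tmul v x => simp

theorem lTensor_rTensor {B : Type*} [AddCommGroup B] [Module k B]
    (f : V →ₗ[k] W) (g : A →ₗ[k] B) (z : V ⊗[k] A) :
    g.lTensor W (f.rTensor A z) = f.rTensor B (g.lTensor V z) := by
  induction z with
  | zero => simp
  | add x y hx hy => simp only [map_add, hx, hy]
  | tmul v x => simp

theorem rTensor_rTensor_coact {c : V →ₗ[k] V ⊗[k] A} {d : W →ₗ[k] W ⊗[k] A}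
    (f : V →ₗ[k] W) (hf : ∀ x, d (f x) = f.rTensor A (c x)) (z : V ⊗[k] A) :
    d.rTensor A (f.rTensor A z) = (f.rTensor A).rTensor A (c.rTensor A z) := by
  induction z with
  | zero => simp
  | add x y hx hy => simp only [map_add, hx, hy]
  | tmul v x => simp [hf]

end Tensor

section Transfer

variable {k A}
variable {V W Z : Type*} [AddCommGroup V] [Module k V] [Module Aᵐᵒᵖ V] [IsScalarTower k Aᵐᵒᵖ V]
  [AddCommGroup W] [Module k W] [Module Aᵐᵒᵖ W] [IsScalarTower k Aᵐᵒᵖ W]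
  [AddCommGroup Z] [Module k Z] [Module Aᵐᵒᵖ Z] [IsScalarTower k Aᵐᵒᵖ Z]

theorem tens_twist (f : V →ₗ[Aᵐᵒᵖ] W) (t : A ⊗[k] (A ⊗[k] A)) (z : V ⊗[k] A) :
    tens k A f (twist k A V t z) = twist k A W t (tens k A f z) := by
  induction t with
  | zero => simp
  | add x y hx hy => simp only [map_add, LinearMap.add_apply, hx, hy]
  | tmul a t =>
    induction t with
    | zero => simp
    | add x y hx hy => simp only [tmul_add, map_add, LinearMap.add_apply, hx, hy]
    | tmul b c =>
      induction z with
      | zero => simp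
      | add x y hx hy => simp only [map_add, hx, hy]
      | tmul v x => simp

theorem tens_comp (f : V →ₗ[Aᵐᵒᵖ] W) (g : W →ₗ[Aᵐᵒᵖ] Z) (z : V ⊗[k] A) :
    tens k A g (tens k A f z) = tens k A (g ∘ₗ f) z := by
  induction z with
  | zero => simp
  | add x y hx hy => simp only [map_add, hx, hy]
  | tmul v x => simp

theorem tens_zero : tens k A (0 : V →ₗ[Aᵐᵒᵖ] W) = 0 :=
  LinearMap.rTensor_zero A

theorem tens_add (f g : V →ₗ[Aᵐᵒᵖ] W) : tens k A (f + g) = tens k A f + tens k A g :=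
  LinearMap.rTensor_add A (f.restrictScalars k) (g.restrictScalars k)

theorem tens_neg (f : V →ₗ[Aᵐᵒᵖ] W) : tens k A (-f) = -tens k A f :=
  LinearMap.rTensor_neg (f.restrictScalars k)

theorem tens_sub (f g : V →ₗ[Aᵐᵒᵖ] W) : tens k A (f - g) = tens k A f - tens k A g :=
  LinearMap.rTensor_sub (f.restrictScalars k) (g.restrictScalars k)

theorem tens_nsmul (n : ℕ) (f : V →ₗ[Aᵐᵒᵖ] W) : tens k A (n • f) = n • tens k A f := by
  induction n with
  | zero => simp only [zero_smul, tens_zero]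
  | succ n ih => simp only [succ_nsmul, tens_add, ih]

theorem tens_zsmul (n : ℤ) (f : V →ₗ[Aᵐᵒᵖ] W) : tens k A (n • f) = n • tens k A f := by
  cases n with
  | ofNat n => simp only [Int.ofNat_eq_natCast, natCast_zsmul, tens_nsmul]
  | negSucc n => simp only [negSucc_zsmul, tens_neg, tens_nsmul]

theorem tens_injective {f : V →ₗ[Aᵐᵒᵖ] W} (hf : Function.Injective f) :
    Function.Injective (tens k A f) :=
  Module.Flat.rTensor_preserves_injective_linearMap (M := A) (f.restrictScalars k) hf

/-- The three axioms, at one vector. -/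
structure AxiomsAt (c : V →ₗ[k] V ⊗[k] A) (x : V) : Prop where
  coassoc : TensorProduct.assoc k V A A (c.rTensor A (c x)) =
    (Coalgebra.comul (R := k) (A := A)).lTensor V (c x)
  counit : TensorProduct.rid k V ((Coalgebra.counit (R := k) (A := A)).lTensor V (c x)) = x
  smul : ∀ a : A, c (op a • x) =
    twist k A V ((Coalgebra.comul (R := k) (A := A)).lTensor A (Coalgebra.comul a)) (c x)

theorem AxiomsAt.add {c : V →ₗ[k] V ⊗[k] A} {x y : V} (hx : AxiomsAt c x) (hy : AxiomsAt c y) :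
    AxiomsAt c (x + y) where
  coassoc := by simp only [map_add, hx.coassoc, hy.coassoc]
  counit := by simp only [map_add, hx.counit, hy.counit]
  smul a := by simp only [smul_add, map_add, hx.smul, hy.smul]

theorem axiomsAt_coact [YetterDrinfeld k A V] (x : V) : AxiomsAt (coact k A V) x :=
  ⟨RightComodule.coassoc x, RightComodule.counit x, YetterDrinfeld.coact_smul x⟩

/-- Yetter-Drinfeld modules from the three axioms. -/
abbrev ofAxioms (c : V →ₗ[k] V ⊗[k] A) (h : ∀ x, AxiomsAt c x) : YetterDrinfeld k A V where
  coact := c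
  coassoc x := (h x).coassoc
  counit x := (h x).counit
  coact_smul x := (h x).smul

/-- The axioms pass to images. -/
theorem AxiomsAt.map {c : V →ₗ[k] V ⊗[k] A} {d : W →ₗ[k] W ⊗[k] A}
    (f : V →ₗ[Aᵐᵒᵖ] W) (hf : ∀ x, d (f x) = tens k A f (c x)) {x : V} (hx : AxiomsAt c x) :
    AxiomsAt d (f x) where
  coassoc := by
    rw [hf, rTensor_rTensor_coact (f.restrictScalars k) hf, assoc_rTensor, hx.coassoc,
      lTensor_rTensor]
  counit := by
    rw [hf, rid_lTensor, hx.counit]; rfl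
  smul a := by
    rw [← map_smul, hf, hx.smul, tens_twist, hf]

/-- The axioms pass to subobjects. -/
theorem AxiomsAt.of_injective {c : V →ₗ[k] V ⊗[k] A} {d : W →ₗ[k] W ⊗[k] A}
    {f : V →ₗ[Aᵐᵒᵖ] W} (hi : Function.Injective f) (hf : ∀ x, d (f x) = tens k A f (c x)) {x : V}
    (hx : AxiomsAt d (f x)) : AxiomsAt c x where
  coassoc := by
    have h3 : Function.Injective ((f.restrictScalars k).rTensor (A ⊗[k] A)) :=
      Module.Flat.rTensor_preserves_injective_linearMap (M := A ⊗[k] A) (f.restrictScalars k) hi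
    apply h3
    rw [← assoc_rTensor, ← rTensor_rTensor_coact (f.restrictScalars k) hf, ← lTensor_rTensor,
      ← hf, hx.coassoc]
  counit := by
    apply hi
    have := rid_lTensor (f.restrictScalars k) (Coalgebra.counit (R := k) (A := A)) (c x)
    rw [LinearMap.restrictScalars_apply] at this
    rw [← this, ← hf, hx.counit]
  smul a := by
    apply tens_injective (k := k) hi
    rw [tens_twist, ← hf, ← hf, map_smul, hx.smul]

end Transfer

end YD

/-! ### The category of Yetter-Drinfeld modules -/

section Category

/-- The objects of the category of right-right Yetter-Drinfeld modules over `A`. -/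
structure YDCat (k A : Type u) [Field k] [Ring A] [HopfAlgebra k A] where
  /-- Bundle a Yetter-Drinfeld module. -/
  of ::
  /-- The underlying space. -/
  carrier : Type u
  [addCommGroup : AddCommGroup carrier]
  [module : Module k carrier]
  [moduleOp : Module Aᵐᵒᵖ carrier]
  [isScalarTower : IsScalarTower k Aᵐᵒᵖ carrier]
  [yetterDrinfeld : YetterDrinfeld k A carrier]

attribute [instance] YDCat.addCommGroup YDCat.module YDCat.moduleOp YDCat.isScalarTower
  YDCat.yetterDrinfeld

variable {k A : Type u} [Field k] [Ring A] [HopfAlgebra k A]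

instance : CoeSort (YDCat k A) (Type u) := ⟨YDCat.carrier⟩

namespace YDCat

/-- Morphisms of Yetter-Drinfeld modules: the `A`-linear and `A`-colinear maps. -/
@[ext]
structure Hom (V W : YDCat k A) where
  /-- The underlying `A`-linear map. -/
  lin : V →ₗ[Aᵐᵒᵖ] W
  colinear : ∀ x : V, coact k A W (lin x) = tens k A lin (coact k A V x)

instance : Category.{u} (YDCat k A) where
  Hom V W := Hom V W
  id V := ⟨LinearMap.id, fun x => by
    have : (LinearMap.id : V →ₗ[Aᵐᵒᵖ] V).restrictScalars k = LinearMap.id := rfl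
    simp [tens, this]⟩
  comp f g := ⟨g.lin ∘ₗ f.lin, fun x => by
    rw [← tens_comp, ← f.colinear, ← g.colinear]; rfl⟩

variable {V W Z : YDCat k A}

/-- The `A`-linear map underlying a morphism. -/
abbrev lin (f : V ⟶ W) : V →ₗ[Aᵐᵒᵖ] W := Hom.lin f

theorem colinear (f : V ⟶ W) (x : V) :
    coact k A W (lin f x) = tens k A (lin f) (coact k A V x) := Hom.colinear f x

@[ext]
theorem hom_ext {f g : V ⟶ W} (h : ∀ x, lin f x = lin g x) : f = g :=
  Hom.ext (LinearMap.ext h)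

@[simp] theorem lin_id (V : YDCat k A) : lin (𝟙 V) = LinearMap.id := rfl

@[simp] theorem lin_comp (f : V ⟶ W) (g : W ⟶ Z) : lin (f ≫ g) = lin g ∘ₗ lin f := rfl

/-! #### Additive structure -/

instance : Zero (V ⟶ W) := ⟨⟨0, fun x => by rw [tens_zero]; simp⟩⟩
instance : Add (V ⟶ W) := ⟨fun f g => ⟨lin f + lin g, fun x => by
  rw [tens_add]; simp only [LinearMap.add_apply, map_add, colinear]⟩⟩
instance : Neg (V ⟶ W) := ⟨fun f => ⟨-lin f, fun x => by
  rw [tens_neg]; simp only [LinearMap.neg_apply, map_neg, colinear]⟩⟩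
instance : Sub (V ⟶ W) := ⟨fun f g => ⟨lin f - lin g, fun x => by
  rw [tens_sub]; simp only [LinearMap.sub_apply, map_sub, colinear]⟩⟩
instance : SMul ℕ (V ⟶ W) := ⟨fun n f => ⟨n • lin f, fun x => by
  rw [tens_nsmul]; simp only [LinearMap.smul_apply, map_nsmul, colinear]⟩⟩
instance : SMul ℤ (V ⟶ W) := ⟨fun n f => ⟨n • lin f, fun x => by
  rw [tens_zsmul]; simp only [LinearMap.smul_apply, map_zsmul, colinear]⟩⟩

theorem lin_injective : Function.Injective (lin : (V ⟶ W) → (V →ₗ[Aᵐᵒᵖ] W)) :=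
  fun _ _ h => Hom.ext h

instance : AddCommGroup (V ⟶ W) :=
  lin_injective.addCommGroup lin rfl (fun _ _ => rfl) (fun _ => rfl) (fun _ _ => rfl)
    (fun _ _ => rfl) (fun _ _ => rfl)

@[simp] theorem lin_zero : lin (0 : V ⟶ W) = 0 := rfl

@[simp] theorem lin_add (f g : V ⟶ W) : lin (f + g) = lin f + lin g := rfl

instance : Preadditive (YDCat k A) where
  add_comp _ _ _ f g h := by ext x; simp
  comp_add _ _ _ f g h := by ext x; simp

/-! #### Factorizations -/

/-- Factorization through an injective morphism. -/
def lift (f : V ⟶ W) (hf : Function.Injective (lin f)) (g : Z ⟶ W)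
    (h : LinearMap.range (lin g) ≤ LinearMap.range (lin f)) : Z ⟶ V :=
  let l : Z →ₗ[Aᵐᵒᵖ] V := (LinearEquiv.ofInjective (lin f) hf).symm.toLinearMap ∘ₗ
    (lin g).codRestrict (LinearMap.range (lin f)) (fun x => h ⟨x, rfl⟩)
  have hl : lin f ∘ₗ l = lin g := by
    ext x
    exact congrArg Subtype.val ((LinearEquiv.ofInjective (lin f) hf).apply_symm_apply _)
  ⟨l, fun x => by
    apply tens_injective (k := k) hf
    rw [tens_comp, hl, ← colinear, ← colinear]
    exact congrArg _ (LinearMap.congr_fun hl x)⟩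

theorem lift_comp (f : V ⟶ W) (hf : Function.Injective (lin f)) (g : Z ⟶ W)
    (h : LinearMap.range (lin g) ≤ LinearMap.range (lin f)) : lift f hf g h ≫ f = g := by
  ext x
  exact congrArg Subtype.val ((LinearEquiv.ofInjective (lin f) hf).apply_symm_apply _)

/-- Factorization through a surjective morphism. -/
def desc (f : V ⟶ W) (hf : Function.Surjective (lin f)) (g : V ⟶ Z)
    (h : LinearMap.ker (lin f) ≤ LinearMap.ker (lin g)) : W ⟶ Z :=
  let l : W →ₗ[Aᵐᵒᵖ] Z := (LinearMap.ker (lin f)).liftQ (lin g) h ∘ₗ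
    ((lin f).quotKerEquivOfSurjective hf).symm.toLinearMap
  have hl : l ∘ₗ lin f = lin g := by
    ext x
    have : ((lin f).quotKerEquivOfSurjective hf).symm (lin f x) =
        (LinearMap.ker (lin f)).mkQ x := by
      rw [LinearEquiv.symm_apply_eq]; rfl
    simp [l, this]
  ⟨l, fun y => by
    obtain ⟨x, rfl⟩ := hf y
    rw [colinear f, tens_comp, hl, ← colinear g]
    exact congrArg _ (LinearMap.congr_fun hl x)⟩

theorem comp_desc (f : V ⟶ W) (hf : Function.Surjective (lin f)) (g : V ⟶ Z)
    (h : LinearMap.ker (lin f) ≤ LinearMap.ker (lin g)) : f ≫ desc f hf g h = g := by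
  ext x
  have : ((lin f).quotKerEquivOfSurjective hf).symm (lin f x) =
      (LinearMap.ker (lin f)).mkQ x := by
    rw [LinearEquiv.symm_apply_eq]; rfl
  simp [desc, lin, this]

theorem mono_of_injective (f : V ⟶ W) (hf : Function.Injective (lin f)) : Mono f :=
  ⟨fun g h e => by
    ext x
    exact hf (congrArg (fun t => lin t x) e)⟩

theorem epi_of_surjective (f : V ⟶ W) (hf : Function.Surjective (lin f)) : Epi f :=
  ⟨fun g h e => by
    ext y
    obtain ⟨x, rfl⟩ := hf y
    exact congrArg (fun t => lin t x) e⟩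

/-! #### Kernels -/

/-- The coaction maps the kernel `K` of `f` to `K ⊗ A`. -/
theorem coact_ker_mem (f : V ⟶ W) (x : LinearMap.ker (lin f)) :
    coact k A V x ∈ LinearMap.range (tens k A (LinearMap.ker (lin f)).subtype) := by
  have hex : Function.Exact (((LinearMap.ker (lin f)).subtype).restrictScalars k)
      ((lin f).restrictScalars k) := by
    intro y
    constructor
    · intro hy; exact ⟨⟨y, hy⟩, rfl⟩
    · rintro ⟨z, rfl⟩; exact z.2
  have := Module.Flat.rTensor_exact A hex
  refine (this _).1 ?_
  have h := colinear f x.1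
  rw [show lin f x.1 = 0 from x.2, map_zero] at h
  exact h.symm

/-- The kernel of `f`, with the restricted coaction. -/
def kerCoact (f : V ⟶ W) :
    LinearMap.ker (lin f) →ₗ[k] LinearMap.ker (lin f) ⊗[k] A :=
  (LinearEquiv.ofInjective (tens k A (LinearMap.ker (lin f)).subtype)
      (tens_injective (Submodule.injective_subtype _))).symm.toLinearMap ∘ₗ
    (coact k A V ∘ₗ ((LinearMap.ker (lin f)).subtype.restrictScalars k)).codRestrict _
      (coact_ker_mem f)

theorem kerCoact_spec (f : V ⟶ W) (x : LinearMap.ker (lin f)) :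
    coact k A V ((LinearMap.ker (lin f)).subtype x) =
      tens k A (LinearMap.ker (lin f)).subtype (kerCoact f x) := by
  have h := congrArg Subtype.val ((LinearEquiv.ofInjective
    (tens k A (LinearMap.ker (lin f)).subtype)
      (tens_injective (Submodule.injective_subtype _))).apply_symm_apply
        ⟨coact k A V ((LinearMap.ker (lin f)).subtype x), coact_ker_mem f x⟩)
  exact h.symm

/-- The kernel of a morphism. -/
def ker (f : V ⟶ W) : YDCat k A :=
  letI := ofAxioms (kerCoact f) fun _ =>
    AxiomsAt.of_injective (Submodule.injective_subtype _) (kerCoact_spec f) (axiomsAt_coact _)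
  of (LinearMap.ker (lin f))

/-- The inclusion of the kernel. -/
def kerι (f : V ⟶ W) : ker f ⟶ V :=
  ⟨(LinearMap.ker (lin f)).subtype, kerCoact_spec f⟩

theorem kerι_injective (f : V ⟶ W) : Function.Injective (lin (kerι f)) :=
  Submodule.injective_subtype _

theorem range_kerι (f : V ⟶ W) : LinearMap.range (lin (kerι f)) = LinearMap.ker (lin f) :=
  Submodule.range_subtype _

theorem kerι_comp (f : V ⟶ W) : kerι f ≫ f = 0 := by
  ext x; exact x.2

theorem range_le_of_comp_eq_zero {f : V ⟶ W} {g : Z ⟶ V} (h : g ≫ f = 0) :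
    LinearMap.range (lin g) ≤ LinearMap.ker (lin f) := by
  rintro _ ⟨x, rfl⟩
  exact congrArg (fun t => lin t x) h

/-- An injective morphism whose image is the kernel of `f` is a kernel of `f`. -/
def isLimitOfRange (f : V ⟶ W) (i : Z ⟶ V) (hi : Function.Injective (lin i))
    (hr : LinearMap.range (lin i) = LinearMap.ker (lin f)) (w : i ≫ f = 0) :
    IsLimit (KernelFork.ofι i w) :=
  haveI := mono_of_injective i hi
  KernelFork.IsLimit.ofι' i w fun g hg =>
    ⟨lift i hi g (hr ▸ range_le_of_comp_eq_zero hg), lift_comp _ _ _ _⟩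

instance : HasKernels (YDCat k A) where
  has_limit f := ⟨⟨⟨_, isLimitOfRange f (kerι f) (kerι_injective f) (range_kerι f) (kerι_comp f)⟩⟩⟩

/-! #### Cokernels -/

/-- The induced coaction on the cokernel. -/
def cokerCoact (f : V ⟶ W) :
    (W ⧸ LinearMap.range (lin f)) →ₗ[k] (W ⧸ LinearMap.range (lin f)) ⊗[k] A :=
  ((LinearMap.range (lin f)).restrictScalars k).liftQ
      (tens k A (LinearMap.range (lin f)).mkQ ∘ₗ coact k A W) (by
    rintro _ ⟨x, rfl⟩
    rw [LinearMap.mem_ker, LinearMap.comp_apply, colinear, tens_comp,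
      LinearMap.range_mkQ_comp, tens_zero]
    rfl) ∘ₗ
    (Submodule.Quotient.restrictScalarsEquiv k (LinearMap.range (lin f))).symm.toLinearMap

theorem cokerCoact_spec (f : V ⟶ W) (x : W) :
    cokerCoact f ((LinearMap.range (lin f)).mkQ x) =
      tens k A (LinearMap.range (lin f)).mkQ (coact k A W x) := rfl

/-- The cokernel of a morphism. -/
def coker (f : V ⟶ W) : YDCat k A :=
  letI := ofAxioms (cokerCoact f) fun y => by
    obtain ⟨x, rfl⟩ := Submodule.mkQ_surjective _ y
    exact AxiomsAt.map _ (cokerCoact_spec f) (axiomsAt_coact x)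
  of (W ⧸ LinearMap.range (lin f))

/-- The projection to the cokernel. -/
def cokerπ (f : V ⟶ W) : W ⟶ coker f :=
  ⟨(LinearMap.range (lin f)).mkQ, cokerCoact_spec f⟩

theorem cokerπ_surjective (f : V ⟶ W) : Function.Surjective (lin (cokerπ f)) :=
  Submodule.mkQ_surjective _

theorem ker_cokerπ (f : V ⟶ W) : LinearMap.ker (lin (cokerπ f)) = LinearMap.range (lin f) :=
  Submodule.ker_mkQ _

theorem comp_cokerπ (f : V ⟶ W) : f ≫ cokerπ f = 0 := by
  ext x
  exact LinearMap.congr_fun (LinearMap.range_mkQ_comp (lin f)) x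

/-- A surjective morphism whose kernel is the image of `f` is a cokernel of `f`. -/
def isColimitOfKer (f : V ⟶ W) (p : W ⟶ Z) (hp : Function.Surjective (lin p))
    (hr : LinearMap.ker (lin p) = LinearMap.range (lin f)) (w : f ≫ p = 0) :
    IsColimit (CokernelCofork.ofπ p w) :=
  haveI := epi_of_surjective p hp
  CokernelCofork.IsColimit.ofπ' p w fun g hg =>
    ⟨desc p hp g (hr ▸ range_le_of_comp_eq_zero hg), comp_desc _ _ _ _⟩

instance : HasCokernels (YDCat k A) where
  has_colimit f := ⟨⟨⟨_, isColimitOfKer f (cokerπ f) (cokerπ_surjective f) (ker_cokerπ f)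
    (comp_cokerπ f)⟩⟩⟩

/-! #### Monomorphisms and epimorphisms -/

theorem injective_of_mono (f : V ⟶ W) [Mono f] : Function.Injective (lin f) := by
  have h : kerι f = 0 := by rw [← cancel_mono f, kerι_comp, zero_comp]
  rw [← LinearMap.ker_eq_bot, ← range_kerι, h, lin_zero, LinearMap.range_zero]

theorem surjective_of_epi (f : V ⟶ W) [Epi f] : Function.Surjective (lin f) := by
  have h : cokerπ f = 0 := by rw [← cancel_epi f, comp_cokerπ, comp_zero]
  rw [← LinearMap.range_eq_top, ← ker_cokerπ, h, lin_zero, LinearMap.ker_zero]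

instance : IsNormalMonoCategory (YDCat k A) where
  normalMonoOfMono f _ := ⟨{
    Z := coker f
    g := cokerπ f
    w := comp_cokerπ f
    isLimit := isLimitOfRange _ f (injective_of_mono f) (ker_cokerπ f).symm _ }⟩

instance : IsNormalEpiCategory (YDCat k A) where
  normalEpiOfEpi f _ := ⟨{
    W := ker f
    g := kerι f
    w := kerι_comp f
    isColimit := isColimitOfKer _ f (surjective_of_epi f) (range_kerι f).symm _ }⟩

/-! #### Finite products -/

/-- The zero object. -/
def zero (k A : Type u) [Field k] [Ring A] [HopfAlgebra k A] : YDCat k A :=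
  letI := ofAxioms (k := k) (A := A) (V := PUnit.{u + 1}) 0 fun _ =>
    ⟨by simp, Subsingleton.elim _ _, fun _ => by simp⟩
  of PUnit.{u + 1}

instance : HasZeroObject (YDCat k A) :=
  ⟨zero k A, (IsZero.iff_id_eq_zero _).2 (hom_ext fun _ => rfl)⟩

/-- The coaction on the direct sum. -/
def prodCoact (V W : YDCat k A) : V × W →ₗ[k] (V × W) ⊗[k] A :=
  (tens k A (LinearMap.inl Aᵐᵒᵖ V W) ∘ₗ coact k A V).coprod
    (tens k A (LinearMap.inr Aᵐᵒᵖ V W) ∘ₗ coact k A W)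

theorem prodCoact_inl (x : V) : prodCoact V W (LinearMap.inl Aᵐᵒᵖ V W x) =
    tens k A (LinearMap.inl Aᵐᵒᵖ V W) (coact k A V x) := by
  simp [prodCoact]

theorem prodCoact_inr (x : W) : prodCoact V W (LinearMap.inr Aᵐᵒᵖ V W x) =
    tens k A (LinearMap.inr Aᵐᵒᵖ V W) (coact k A W x) := by
  simp [prodCoact]

/-- The direct sum. -/
def prod (V W : YDCat k A) : YDCat k A :=
  letI := ofAxioms (prodCoact V W) fun x => by
    have := (AxiomsAt.map _ prodCoact_inl (axiomsAt_coact x.1)).add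
      (AxiomsAt.map _ prodCoact_inr (axiomsAt_coact x.2))
    simpa using this
  of (V × W)

/-- The first inclusion. -/
def prodInl (V W : YDCat k A) : V ⟶ prod V W := ⟨LinearMap.inl Aᵐᵒᵖ V W, prodCoact_inl⟩

/-- The second inclusion. -/
def prodInr (V W : YDCat k A) : W ⟶ prod V W := ⟨LinearMap.inr Aᵐᵒᵖ V W, prodCoact_inr⟩

theorem tens_id (z : V ⊗[k] A) : tens k A (LinearMap.id : V →ₗ[Aᵐᵒᵖ] V) z = z :=
  LinearMap.rTensor_id_apply A V z

/-- The first projection. -/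
def prodFst (V W : YDCat k A) : prod V W ⟶ V :=
  ⟨LinearMap.fst Aᵐᵒᵖ V W, fun x => by
    change coact k A V x.1 = tens k A (LinearMap.fst Aᵐᵒᵖ V W)
      (tens k A (LinearMap.inl Aᵐᵒᵖ V W) (coact k A V x.1) +
        tens k A (LinearMap.inr Aᵐᵒᵖ V W) (coact k A W x.2))
    rw [map_add, tens_comp, tens_comp, LinearMap.fst_comp_inl, LinearMap.fst_comp_inr, tens_id,
      tens_zero, LinearMap.zero_apply, add_zero]⟩

/-- The second projection. -/
def prodSnd (V W : YDCat k A) : prod V W ⟶ W :=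
  ⟨LinearMap.snd Aᵐᵒᵖ V W, fun x => by
    change coact k A W x.2 = tens k A (LinearMap.snd Aᵐᵒᵖ V W)
      (tens k A (LinearMap.inl Aᵐᵒᵖ V W) (coact k A V x.1) +
        tens k A (LinearMap.inr Aᵐᵒᵖ V W) (coact k A W x.2))
    rw [map_add, tens_comp, tens_comp, LinearMap.snd_comp_inl, LinearMap.snd_comp_inr, tens_id,
      tens_zero, LinearMap.zero_apply, zero_add]⟩

instance : HasBinaryBiproducts (YDCat k A) where
  has_binary_biproduct V W := hasBinaryBiproduct_of_total
    { pt := prod V W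
      fst := prodFst V W
      snd := prodSnd V W
      inl := prodInl V W
      inr := prodInr V W
      inl_fst := hom_ext fun _ => rfl
      inl_snd := hom_ext fun _ => rfl
      inr_fst := hom_ext fun _ => rfl
      inr_snd := hom_ext fun _ => rfl }
    (hom_ext fun x => Prod.ext (add_zero x.1) (zero_add x.2))

instance : HasFiniteProducts (YDCat k A) := hasFiniteProducts_of_has_binary_and_terminal

instance : Abelian (YDCat k A) where

end YDCat

/-! ### Gerstenhaber-Schack cohomology -/

variable (k A)

/-- The ground field `k`, as the carrier of the trivial Yetter-Drinfeld module. -/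
def Triv (_k _A : Type u) : Type u := _k

instance : AddCommGroup (Triv k A) := inferInstanceAs (AddCommGroup k)

instance : Module k (Triv k A) := inferInstanceAs (Module k k)

/-- The trivial right action `x · a = x ε(a)`. -/
instance : Module Aᵐᵒᵖ (Triv k A) :=
  Module.compHom (Triv k A)
    ((Bialgebra.counitAlgHom k A : A →+* k).fromOpposite fun _ _ => mul_comm _ _)

theorem Triv.op_smul (a : A) (x : Triv k A) :
    op a • x = Coalgebra.counit (R := k) a • x := rfl

instance : IsScalarTower k Aᵐᵒᵖ (Triv k A) where
  smul_assoc c a x := by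
    obtain ⟨a, rfl⟩ := op_surjective a
    rw [← op_smul, Triv.op_smul, Triv.op_smul, map_smul, smul_assoc]

theorem twist_triv (x : Triv k A) (t : A ⊗[k] A) :
    twist k A (Triv k A) ((Coalgebra.comul (R := k) (A := A)).lTensor A t) (x ⊗ₜ 1) =
      x ⊗ₜ LinearMap.mul' k A ((HopfAlgebra.antipode k).rTensor A t) := by
  have key (a : A) (u : A ⊗[k] A) : twist k A (Triv k A) (a ⊗ₜ u) (x ⊗ₜ 1) =
      x ⊗ₜ (HopfAlgebra.antipode k a *
        TensorProduct.lid k A ((Coalgebra.counit (R := k) (A := A)).rTensor A u)) := by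
    induction u with
    | zero => simp
    | add y z hy hz => simp only [tmul_add, map_add, LinearMap.add_apply, hy, hz, mul_add]
    | tmul b c => simp [Triv.op_smul, smul_tmul]
  induction t with
  | zero => simp
  | add y z hy hz => simp only [tmul_add, map_add, LinearMap.add_apply, hy, hz]
  | tmul a b => simp [key]

/-- The trivial coaction `x ↦ x ⊗ 1`. -/
instance : YetterDrinfeld k A (Triv k A) where
  coact := (TensorProduct.mk k (Triv k A) A).flip 1
  coassoc x := by simp [Algebra.TensorProduct.one_def]
  counit x := by simp
  coact_smul x a := by
    change (op a • x) ⊗ₜ[k] (1 : A) = twist k A (Triv k A) _ (x ⊗ₜ 1)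
    rw [twist_triv, HopfAlgebra.mul_antipode_rTensor_comul_apply, Triv.op_smul,
      Algebra.algebraMap_eq_smul_one, smul_tmul]

/-- The trivial Yetter-Drinfeld module. -/
def trivialYD : YDCat k A := YDCat.of (Triv k A)

/-- Gerstenhaber-Schack cohomology `Hⁿ_GS(A, V)`, for Yetter-Drinfeld modules `V`: the group
`Extⁿ(k, V)` in the category of Yetter-Drinfeld modules, where `k` is the trivial one. -/
def GSCohomology (V : YDCat k A) (n : ℕ) : Type (u + 1) :=
  letI := HasExt.standard (YDCat k A)
  Abelian.Ext.{u + 1} (trivialYD k A) V n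

instance (V : YDCat k A) (n : ℕ) : AddCommGroup (GSCohomology k A V n) :=
  letI := HasExt.standard (YDCat k A)
  inferInstanceAs (AddCommGroup (Abelian.Ext.{u + 1} (trivialYD k A) V n))

/-- The Gerstenhaber-Schack cohomological dimension of the Hopf algebra `A`: the supremum of the
`n` with `Hⁿ_GS(A, V) ≠ 0` for some Yetter-Drinfeld module `V`. -/
def cdGS : ℕ∞ :=
  sSup {d : ℕ∞ | ∃ n : ℕ, d = n ∧ ∃ V : YDCat k A, Nontrivial (GSCohomology k A V n)}

end Category

end HopfCD

end

noncomputable section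

namespace HopfCD


/-! ### Convolution -/

section Convolution

open Coalgebra HopfAlgebra WithConv

variable {k A B : Type*} [Field k] [Ring A] [HopfAlgebra k A] [Ring B] [Algebra k B]

/-! Both dimensions are projective dimensions: `cd` that of the bimodule `A`, `cdGS` that of the
trivial Yetter-Drinfeld module `k`. They are compared along `bimoduleFunctor`, which sends `V` to `A
⊗ V` with `a · (x ⊗ v) · b = a x b₁ ⊗ v · b₂`. This functor is exact, sends `k` to `A`, and sends
the free Yetter-Drinfeld module on a comodule to a free bimodule. Every Yetter-Drinfeld module is a
quotient of a free one, so dimension shifting (`hasProjectiveDimensionLT_succ_iff_of_functor`) gives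
equality as soon as the functor reflects projectivity.

Reflection (`projective_of_projective_bimoduleFunctor`) is where the hypotheses enter. Let `A ⊗ P`
be projective, `e : E ⟶ B` epi and `f : P ⟶ B`. A bimodule lift of `A ⊗ f` through `A ⊗ e`, followed
by `ε ⊗ id`, yields an `A`-linear `t` with `e ∘ t = f`, in general not colinear. Cosemisimplicity
provides a normalized integral `h`, and the average `v ↦ t(v₀)₀ h(t(v₀)₁ S(v₁))` is colinear and
still lifts `f`.

It remains to see that averaging preserves `A`-linearity. This follows from the twisted trace
property `h(xy) = h(y S²(x))` (`apply_mul_comm`), which is deduced from `S⁴ = id`. -/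

theorem algHom_convMul_antipode (f : A →ₐ[k] B) :
    toConv f.toLinearMap * toConv (f.toLinearMap ∘ₗ antipode k) = 1 := by
  have := LinearMap.algHom_comp_convMul_distrib f
    (toConv LinearMap.id) (toConv (antipode k (A := A)))
  rw [LinearMap.id_mul_antipode] at this
  apply WithConv.ext
  refine Eq.trans this.symm ?_
  ext x
  simp [LinearMap.convOne_def]

theorem antipode_convMul_algHom (f : A →ₐ[k] B) :
    toConv (f.toLinearMap ∘ₗ antipode k) * toConv f.toLinearMap = 1 := by
  have := LinearMap.algHom_comp_convMul_distrib f
    (toConv (antipode k (A := A))) (toConv LinearMap.id)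
  rw [LinearMap.antipode_mul_id] at this
  apply WithConv.ext
  refine Eq.trans this.symm ?_
  ext x
  simp [LinearMap.convOne_def]

/-- Uniqueness of inverses in the convolution algebra of maps `A → A ⊗ A`: the left side is a left
inverse of `Δ`. The right side is a right inverse, because `Δ = i₁ * i₂` for the two inclusions and
the inverse of a product is the product of the inverses in reverse order. -/
theorem comul_antipode (a : A) : comul (R := k) (antipode k a) =
    TensorProduct.map (antipode k) (antipode k) (TensorProduct.comm k A A (comul a)) := by
  let i₁ : A →ₐ[k] A ⊗[k] A := Algebra.TensorProduct.includeLeft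
  let i₂ : A →ₐ[k] A ⊗[k] A := Algebra.TensorProduct.includeRight
  have h₁ : toConv (comul (R := k) (A := A)) = toConv i₁.toLinearMap * toConv i₂.toLinearMap := by
    ext x
    simp [(ℛ k x).convMul_apply, i₁, i₂, (ℛ k x).eq]
  have h₂ : toConv (TensorProduct.map (antipode k) (antipode k) ∘ₗ
      (TensorProduct.comm k A A).toLinearMap ∘ₗ comul) =
      toConv (i₂.toLinearMap ∘ₗ antipode k) * toConv (i₁.toLinearMap ∘ₗ antipode k) := by
    ext x
    rw [(ℛ k x).convMul_apply]
    simp [i₁, i₂, ← (ℛ k x).eq]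
  have hr : toConv (comul (R := k) (A := A)) * toConv
      (TensorProduct.map (antipode k) (antipode k) ∘ₗ (TensorProduct.comm k A A).toLinearMap ∘ₗ
        comul) = 1 := by
    rw [h₁, h₂, mul_assoc, ← mul_assoc (toConv i₂.toLinearMap), algHom_convMul_antipode, one_mul,
      algHom_convMul_antipode]
  exact LinearMap.congr_fun (congrArg ofConv
    (left_inv_eq_right_inv (antipode_convMul_algHom (Bialgebra.comulAlgHom k A)) hr)) a

/-- The representation of `Δ(S(a))` induced by one of `Δ(a)`. -/
def reprAntipode {ι : Type*} {a : A} (r : Repr k a ι) : Repr k (antipode k a) ι where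
  index := r.index
  left i := antipode k (r.right i)
  right i := antipode k (r.left i)
  eq := by rw [comul_antipode, ← r.eq]; simp

end Convolution

/-! ### Integrals on Hopf algebras -/

section Integral

open Coalgebra HopfAlgebra WithConv

/-- A normalized two-sided integral on a Hopf algebra, through left invariance and invariance
under the antipode. -/
structure IsNormalizedIntegral {k A : Type*} [Field k] [Ring A] [HopfAlgebra k A]
    (h : A →ₗ[k] k) : Prop where
  one : h 1 = 1
  left : ∀ a : A, TensorProduct.rid k A (h.lTensor A (comul a)) = h a • (1 : A)
  antipode : ∀ a, h (antipode k a) = h a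

theorem antipode_injective {k A : Type*} [Field k] [Ring A] [HopfAlgebra k A]
    (hS : ∀ a : A, antipode k (antipode k (antipode k (antipode k a))) = a) :
    Function.Injective (antipode k (A := A)) := fun a b hab => by
  rw [← hS a, ← hS b, hab]

/-- The regular comodule. -/
abbrev regularComodule (k A : Type*) [Field k] [Ring A] [HopfAlgebra k A] :
    RightComodule k A A where
  coact := comul
  coassoc := coassoc_apply
  counit x := by simp

/-- The line `k · 1` is a subcomodule of the regular comodule, so it has a subcomodule complement
`W`; `h` is the projection to `k · 1` along `W`. Since `Δ(W) ⊆ W ⊗ A`, both sides vanish on `W`, and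
they agree at `1`. -/
theorem exists_right_integral {k A : Type u} [Field k] [Ring A] [HopfAlgebra k A]
    (hA : IsCosemisimple k A) : ∃ h : A →ₗ[k] k, h 1 = 1 ∧
      ∀ a : A, TensorProduct.lid k A (h.rTensor A (comul a)) = h a • (1 : A) := by
  let _ := regularComodule k A
  have h1 : (1 : A) ≠ 0 := fun h0 => by
    have := congrArg (counit (R := k)) h0
    simp at this
  obtain ⟨W, hW, hc⟩ := hA A (Submodule.span k {(1 : A)}) fun w hw => by
    obtain ⟨c, rfl⟩ := Submodule.mem_span_singleton.1 hw
    refine ⟨(⟨1, Submodule.mem_span_singleton_self 1⟩ : Submodule.span k {(1 : A)}) ⊗ₜ (c • 1), ?_⟩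
    change _ = comul (c • (1 : A))
    simp [Algebra.TensorProduct.one_def]
  let h : A →ₗ[k] k := (LinearEquiv.toSpanNonzeroSingleton k A 1 h1).symm.toLinearMap ∘ₗ
    Submodule.projectionOnto _ _ hc
  have hh1 : h 1 = 1 := by
    have := Submodule.projectionOnto_apply_left hc
      ⟨(1 : A), Submodule.mem_span_singleton_self 1⟩
    simp only [h, LinearMap.comp_apply]
    rw [this]
    exact LinearEquiv.coord_self k A 1 h1
  have hhW : ∀ w ∈ W, h w = 0 := fun w hw => by
    simp [h, (Submodule.projectionOnto_apply_eq_zero_iff hc).2 hw]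
  refine ⟨h, hh1, fun a => ?_⟩
  obtain ⟨x, hx, w, hw, rfl⟩ := Submodule.mem_sup.1
    (hc.sup_eq_top ▸ Submodule.mem_top : a ∈ Submodule.span k {(1 : A)} ⊔ W)
  obtain ⟨c, rfl⟩ := Submodule.mem_span_singleton.1 hx
  obtain ⟨z, hz⟩ := hW w hw
  have key : TensorProduct.lid k A (h.rTensor A (comul w)) = 0 := by
    change W.subtype.rTensor A z = comul w at hz
    rw [← hz, ← LinearMap.comp_apply (h.rTensor A), ← LinearMap.rTensor_comp,
      show h ∘ₗ W.subtype = 0 from LinearMap.ext fun w => hhW _ w.2]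
    simp
  rw [map_add, map_add, map_add, key, map_add, hhW w hw]
  simp [Algebra.TensorProduct.one_def, hh1]

theorem exists_isNormalizedIntegral {k A : Type u} [Field k] [Ring A] [HopfAlgebra k A]
    (hA : IsCosemisimple k A)
    (hS : ∀ a : A, antipode k (antipode k (antipode k (antipode k a))) = a) :
    ∃ h : A →ₗ[k] k, IsNormalizedIntegral h := by
  obtain ⟨h, h1, hr⟩ := exists_right_integral hA
  -- The antipode reverses `Δ`, so `h ∘ S` is invariant on the other side. Injectivity of `S` is
  -- what allows the cancellation.
  have hl (a : A) : TensorProduct.rid k A ((h ∘ₗ antipode k).lTensor A (comul a)) =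
      h (antipode k a) • (1 : A) := by
    apply antipode_injective hS
    have := hr (antipode k a)
    rw [← (reprAntipode (ℛ k a)).eq] at this
    rw [map_smul, antipode_one, ← this, ← (ℛ k a).eq]
    simp [reprAntipode]
  -- The number `h(a₁) h(S(a₂))` equals `h(a)` by invariance of `h`, and `h(S(a))` by invariance of
  -- `h ∘ S`.
  have heq (a : A) : h (antipode k a) = h a := by
    have e₁ := congrArg (h ∘ₗ antipode k) (hr a)
    have e₂ := congrArg h (hl a)
    rw [← (ℛ k a).eq] at e₁ e₂
    simp only [map_sum, LinearMap.rTensor_tmul, LinearMap.lTensor_tmul, TensorProduct.lid_tmul,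
      TensorProduct.rid_tmul, map_smul, LinearMap.comp_apply, antipode_one, h1, smul_eq_mul,
      mul_one] at e₁ e₂
    rw [← e₁, ← e₂]
    exact Finset.sum_congr rfl fun _ _ => mul_comm _ _
  refine ⟨h, h1, fun a => ?_, heq⟩
  rw [← heq a, ← hl a, show h ∘ₗ antipode k = h from LinearMap.ext heq]

variable {k A : Type*} [Field k] [Ring A] [HopfAlgebra k A] {h : A →ₗ[k] k}

namespace IsNormalizedIntegral

theorem sum_smul (hh : IsNormalizedIntegral h) {ι : Type*} {a : A}
    (r : Repr k a ι) : ∑ i ∈ r.index, h (r.right i) • r.left i = h a • (1 : A) := by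
  simpa [← r.eq] using hh.left a

/-- With `α(y) = h(y z₂) z₁`, left invariance at the product `xz` reads `id * α = h(· z) 1` for
convolution. Convolving with `S` on the left isolates `α`. -/
theorem sum_smul_antipode (hh : IsNormalizedIntegral h) {ι κ : Type*}
    {y z : A} (r : Repr k y ι) (s : Repr k z κ) :
    ∑ i ∈ r.index, h (r.right i * z) • HopfAlgebra.antipode k (r.left i) =
      ∑ j ∈ s.index, h (y * s.right j) • s.left j := by
  let α : WithConv (A →ₗ[k] A) := toConv (∑ j ∈ s.index,
    (h ∘ₗ LinearMap.mulRight k (s.right j)).smulRight (s.left j))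
  have hα : toConv LinearMap.id * α =
      toConv ((h ∘ₗ LinearMap.mulRight k z).smulRight (1 : A)) := by
    ext x
    rw [(ℛ k x).convMul_apply]
    have := hh.sum_smul ((ℛ k x).mul s)
    simpa [α, Repr.mul, Repr.tmul, Repr.induced, Finset.sum_product, Finset.mul_sum] using this
  have := congrArg (fun f : WithConv (A →ₗ[k] A) =>
    (toConv (HopfAlgebra.antipode k) * f : WithConv (A →ₗ[k] A)).ofConv y) hα
  simp only [← mul_assoc, LinearMap.antipode_mul_id, one_mul] at this
  rw [r.convMul_apply] at this
  simpa [α] using this.symm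

local notation "S" => HopfAlgebra.antipode k

theorem sum_smul_left (hh : IsNormalizedIntegral h) (hS : ∀ a : A, S (S (S (S a))) = a)
    {ι κ : Type*} {x w : A} (r : Repr k x ι) (s : Repr k w κ) :
    ∑ i ∈ r.index, h (r.right i * S w) • r.left i =
      ∑ j ∈ s.index, h (x * S (s.left j)) • s.right j := by
  apply antipode_injective hS
  have := hh.sum_smul_antipode r (reprAntipode s)
  simpa [reprAntipode] using this

/-- This is `sum_smul_antipode` at `y = S(x)`, which carries `S²` on the left-hand vectors. Applying
`S²` to the claim produces it there and turns `S²(w₁)` into `S⁴(w₁) = w₁`. -/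
theorem sum_smul_right (hh : IsNormalizedIntegral h) (hS : ∀ a : A, S (S (S (S a))) = a)
    {ι κ : Type*} {x w : A} (r : Repr k x ι) (s : Repr k w κ) :
    ∑ i ∈ r.index, h (S (r.left i) * w) • r.right i =
      ∑ j ∈ s.index, h (S x * s.right j) • S (S (s.left j)) := by
  apply antipode_injective hS
  apply antipode_injective hS
  have := hh.sum_smul_antipode (reprAntipode r) s
  simpa [reprAntipode, hS] using this

theorem sum_coassoc (B : A →ₗ[k] A →ₗ[k] k) (g : A →ₗ[k] k) {ι : Type*} {a : A}
    (r : Repr k a ι) :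
    ∑ i ∈ r.index, ∑ l ∈ (ℛ k (r.left i)).index,
        B ((ℛ k (r.left i)).left l) ((ℛ k (r.left i)).right l) * g (r.right i) =
      ∑ i ∈ r.index, ∑ l ∈ (ℛ k (r.right i)).index,
        B (r.left i) ((ℛ k (r.right i)).left l) * g ((ℛ k (r.right i)).right l) := by
  have := congrArg (LinearMap.mul' k k ∘ₗ TensorProduct.map (TensorProduct.lift B) g ∘ₗ
    (TensorProduct.assoc k A A A).symm.toLinearMap)
    (sum_tmul_tmul_eq r (fun i => ℛ k (r.left i)) (fun i => ℛ k (r.right i)))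
  simpa using this

/-- If `S⁴ = id`, the two natural pairings of `A` with itself given by the integral agree. -/
theorem apply_mul_antipode (hh : IsNormalizedIntegral h) (hS : ∀ a : A, S (S (S (S a))) = a)
    (x w : A) : h (x * S w) = h (S x * w) := by
  let r := ℛ k x
  let s := ℛ k w
  -- In Sweedler notation: insert `h(S(x₁) x₂) = ε(x₁)` to get `h(S(x₁) x₂) h(x₃ S(w))`; move the
  -- coproduct to `w` by `sum_smul_left`, giving `h(S(x₁) w₂) h(x₂ S(w₁))`; move it again by
  -- `sum_smul_right`, giving `h(S²(w₂) S(w₁)) h(S(x) w₃)`. The first factor collapses because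
  -- `S²(w₂) S(w₁) = S(w₁ S(w₂))`.
  calc h (x * S w)
      = ∑ i ∈ r.index, ∑ l ∈ (ℛ k (r.left i)).index,
          h (S ((ℛ k (r.left i)).left l) * (ℛ k (r.left i)).right l) * h (r.right i * S w) := by
        simp only [← Finset.sum_mul, ← map_sum, sum_antipode_mul_eq_smul, map_smul, hh.one,
          smul_eq_mul, mul_one]
        conv_lhs => rw [← sum_counit_smul r]
        simp [Finset.sum_mul]
    _ = ∑ i ∈ r.index, ∑ l ∈ (ℛ k (r.right i)).index,
          h (S (r.left i) * (ℛ k (r.right i)).left l) * h ((ℛ k (r.right i)).right l * S w) :=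
        sum_coassoc ((LinearMap.mul k A).compr₂ h ∘ₗ S) (h ∘ₗ LinearMap.mulRight k (S w)) r
    _ = ∑ i ∈ r.index, h (S (r.left i) * ∑ j ∈ s.index, h (r.right i * S (s.left j)) • s.right j) := by
        refine Finset.sum_congr rfl fun i _ => ?_
        rw [← hh.sum_smul_left hS (ℛ k (r.right i)) s]
        simp [Finset.mul_sum, mul_comm]
    _ = ∑ j ∈ s.index, h ((∑ i ∈ r.index, h (S (r.left i) * s.right j) • r.right i) *
          S (s.left j)) := by
        simp only [Finset.mul_sum, Finset.sum_mul, map_sum, mul_smul_comm, smul_mul_assoc,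
          map_smul, smul_eq_mul]
        rw [Finset.sum_comm]
        simp only [mul_comm]
    _ = ∑ j ∈ s.index, ∑ l ∈ (ℛ k (s.right j)).index,
          h (S (S ((ℛ k (s.right j)).left l)) * S (s.left j)) *
            h (S x * (ℛ k (s.right j)).right l) := by
        refine Finset.sum_congr rfl fun j _ => ?_
        rw [hh.sum_smul_right hS r (ℛ k (s.right j))]
        simp [Finset.sum_mul, mul_comm]
    _ = ∑ j ∈ s.index, ∑ l ∈ (ℛ k (s.left j)).index,
          h (S (S ((ℛ k (s.left j)).right l)) * S ((ℛ k (s.left j)).left l)) *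
            h (S x * s.right j) :=
        (sum_coassoc (((LinearMap.mul k A).compr₂ h ∘ₗ S ∘ₗ S).flip ∘ₗ S)
          (h ∘ₗ LinearMap.mulLeft k (S x)) s).symm
    _ = h (S x * w) := by
        simp only [← Finset.sum_mul, ← map_sum, ← antipode_mul_antidistrib,
          sum_mul_antipode_eq_smul, map_smul, antipode_one, hh.one, smul_eq_mul, mul_one]
        conv_rhs => rw [← sum_counit_smul s]
        simp [Finset.mul_sum]

/-- The integral is a trace up to the automorphism `S²`. Taking `w = S³(y)` in `apply_mul_antipode`
makes the left side `h(x S⁴(y)) = h(xy)`; invariance of `h` under `S` rewrites the right side. -/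
theorem apply_mul_comm (hh : IsNormalizedIntegral h) (hS : ∀ a : A, S (S (S (S a))) = a)
    (x y : A) : h (x * y) = h (y * S (S x)) := by
  have := hh.apply_mul_antipode hS x (S (S (S y)))
  rwa [hS, ← hh.antipode (S x * _), antipode_mul_antidistrib, hS] at this

end IsNormalizedIntegral

end Integral


/-! ### Averaging linear maps between Yetter-Drinfeld modules -/

section Average

open Coalgebra HopfAlgebra WithConv

variable {k A : Type*} [Field k] [Ring A] [HopfAlgebra k A]

local notation "S" => HopfAlgebra.antipode k

theorem lTensor_comul_comul {ι : Type*} {a : A} (r : Repr k a ι) :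
    (comul (R := k) (A := A)).lTensor A (comul a) =
      ∑ i ∈ r.index, ∑ l ∈ (ℛ k (r.right i)).index,
        r.left i ⊗ₜ[k] ((ℛ k (r.right i)).left l ⊗ₜ[k] (ℛ k (r.right i)).right l) := by
  conv_lhs => rw [← r.eq, map_sum]
  simp only [LinearMap.lTensor_tmul, ← tmul_sum, Repr.eq]

/-- The five-fold Sweedler identity `a₁ S(a₂) ⊗ (a₃ ⊗ a₄ S(a₅)) = 1 ⊗ (a ⊗ 1)`. -/
theorem sum_mul_antipode_tmul (a : A) :
    ∑ i ∈ (ℛ k a).index, ∑ l ∈ (ℛ k ((ℛ k a).right i)).index,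
      ∑ m ∈ (ℛ k ((ℛ k ((ℛ k a).right i)).left l)).index,
      ∑ n ∈ (ℛ k ((ℛ k ((ℛ k ((ℛ k a).right i)).left l)).right m)).index,
        ((ℛ k a).left i * S ((ℛ k ((ℛ k ((ℛ k a).right i)).left l)).left m)) ⊗ₜ[k]
          ((ℛ k ((ℛ k ((ℛ k ((ℛ k a).right i)).left l)).right m)).left n ⊗ₜ[k]
            ((ℛ k ((ℛ k ((ℛ k ((ℛ k a).right i)).left l)).right m)).right n *
              S ((ℛ k ((ℛ k a).right i)).right l))) = 1 ⊗ₜ[k] (a ⊗ₜ[k] 1) := by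
  let j₁ : A →ₐ[k] A ⊗[k] (A ⊗[k] A) := Algebra.TensorProduct.includeLeft
  let j₂ : A →ₐ[k] A ⊗[k] (A ⊗[k] A) :=
    Algebra.TensorProduct.includeRight.comp Algebra.TensorProduct.includeLeft
  let j₃ : A →ₐ[k] A ⊗[k] (A ⊗[k] A) :=
    Algebra.TensorProduct.includeRight.comp Algebra.TensorProduct.includeRight
  -- The bracketing reproduces the nesting of the Sweedler sums in `contract_coact_twist`, where a
  -- second twist is applied inside the first.
  have key : toConv j₁.toLinearMap * (toConv (j₁.toLinearMap ∘ₗ S) *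
      (toConv j₂.toLinearMap * toConv j₃.toLinearMap) * toConv (j₃.toLinearMap ∘ₗ S)) =
      toConv j₂.toLinearMap := by
    rw [mul_assoc, ← mul_assoc (toConv j₁.toLinearMap), algHom_convMul_antipode, one_mul,
      mul_assoc, algHom_convMul_antipode, mul_one]
  have := congrArg (fun f : WithConv (A →ₗ[k] A ⊗[k] (A ⊗[k] A)) => f.ofConv a) key
  simp only [Repr.convMul_apply (ℛ k _)] at this
  simpa [j₁, j₂, j₃, Finset.mul_sum, Finset.sum_mul, Algebra.TensorProduct.one_def] using this

variable {V W Z : Type*} [AddCommGroup V] [Module k V] [AddCommGroup W] [Module k W]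
  [AddCommGroup Z] [Module k Z]

/-- The map `w ⊗ x ⊗ y ↦ h(x S(y)) w`. -/
def contract (h : A →ₗ[k] k) (W : Type*) [AddCommGroup W] [Module k W] :
    (W ⊗[k] A) ⊗[k] A →ₗ[k] W :=
  (TensorProduct.rid k W).toLinearMap ∘ₗ
    (h ∘ₗ LinearMap.mul' k A ∘ₗ (antipode k).lTensor A).lTensor W ∘ₗ
      (TensorProduct.assoc k W A A).toLinearMap

@[simp]
theorem contract_tmul (h : A →ₗ[k] k) (w : W) (x y : A) :
    contract h W ((w ⊗ₜ x) ⊗ₜ y) = h (x * S y) • w := by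
  simp [contract]

theorem contract_map (h : A →ₗ[k] k) (e : W →ₗ[k] Z) (z : (W ⊗[k] A) ⊗[k] A) :
    contract h Z ((e.rTensor A).rTensor A z) = e (contract h W z) := by
  induction z with
  | zero => simp
  | add x y hx hy => simp only [map_add, hx, hy]
  | tmul z y =>
    induction z with
    | zero => simp
    | add x y hx hy => simp only [map_add, add_tmul, hx, hy]
    | tmul w x => simp

theorem contract_comul {h : A →ₗ[k] k} (hh : IsNormalizedIntegral h) (w : W) (x : A) : contract h W
    ((TensorProduct.assoc k W A A).symm ((comul (R := k)).lTensor W (w ⊗ₜ x))) =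
      counit (R := k) x • w := by
  rw [LinearMap.lTensor_tmul, ← (ℛ k x).eq]
  simp only [tmul_sum, map_sum, assoc_symm_tmul, contract_tmul, ← Finset.sum_smul]
  rw [← map_sum, sum_mul_antipode_eq_smul, map_smul, hh.one, smul_eq_mul, mul_one]

variable [Module Aᵐᵒᵖ V] [IsScalarTower k Aᵐᵒᵖ V] [YetterDrinfeld k A V]
variable [Module Aᵐᵒᵖ W] [IsScalarTower k Aᵐᵒᵖ W] [YetterDrinfeld k A W]
variable [Module Aᵐᵒᵖ Z] [IsScalarTower k Aᵐᵒᵖ Z] [YetterDrinfeld k A Z]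

/-- The average `v ↦ f(v₀)₀ h(f(v₀)₁ S(v₁))` of a linear map `f`. -/
def average (h : A →ₗ[k] k) (f : V →ₗ[k] W) : V →ₗ[k] W :=
  contract h W ∘ₗ (coact k A W).rTensor A ∘ₗ f.rTensor A ∘ₗ coact k A V

variable {h : A →ₗ[k] k} (hh : IsNormalizedIntegral h)
include hh

/-- Colinearity turns the average into `f(v)₀ h(f(v)₁ S(f(v)₂))`, and `h(x₁ S(x₂)) = ε(x)` because
`h(1) = 1`. -/
theorem average_of_colinear (f : V →ₗ[k] W)
    (hf : ∀ v, coact k A W (f v) = f.rTensor A (coact k A V v)) : average h f = f := by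
  ext v
  have h1 := (RightComodule.coassoc (f v) : TensorProduct.assoc k W A A ((coact k A W).rTensor A _) = _)
  rw [← LinearEquiv.eq_symm_apply] at h1
  simp only [average, LinearMap.comp_apply]
  rw [← hf, h1]
  have h2 (z : W ⊗[k] A) : contract h W
      ((TensorProduct.assoc k W A A).symm ((comul (R := k)).lTensor W z)) =
      TensorProduct.rid k W ((counit (R := k)).lTensor W z) := by
    induction z with
    | zero => simp
    | add x y hx hy => simp only [map_add, hx, hy]
    | tmul w x => rw [contract_comul hh]; simp
  rw [h2, RightComodule.counit]

omit hh in
theorem average_comp (e : W →ₗ[k] Z)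
    (he : ∀ w, coact k A Z (e w) = e.rTensor A (coact k A W w)) (f : V →ₗ[k] W) :
    average h (e ∘ₗ f) = e ∘ₗ average h f := by
  ext v
  simp only [average, LinearMap.comp_apply, LinearMap.rTensor_comp]
  rw [rTensor_rTensor_coact e he, contract_map]

/-- The hypothesis `hz` holds for every `z` in the image of the coaction. It reduces the claim to
`h(x₂ S(y)) x₁ = h(x S(y₁)) y₂`, which is `sum_smul_left`. This is what makes averages colinear. -/
theorem coact_contract (hS : ∀ a : A, S (S (S (S a))) = a)
    (z : W ⊗[k] A) (y : A)
    (hz : TensorProduct.assoc k W A A ((coact k A W).rTensor A z) = (comul (R := k)).lTensor W z) :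
    coact k A W (contract h W (z ⊗ₜ y)) =
      (contract h W ∘ₗ TensorProduct.mk k _ _ z).rTensor A (comul y) := by
  have h1 (z : W ⊗[k] A) : coact k A W (contract h W (z ⊗ₜ y)) =
      (TensorProduct.rid k A ∘ₗ (h ∘ₗ LinearMap.mulRight k (S y)).lTensor A).lTensor W
        (TensorProduct.assoc k W A A ((coact k A W).rTensor A z)) := by
    induction z with
    | zero => simp
    | add x y hx hy => simp only [map_add, add_tmul, hx, hy]
    | tmul w x =>
      simp only [contract_tmul, LinearMap.rTensor_tmul, map_smul]
      generalize coact k A W w = u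
      induction u with
      | zero => simp
      | add x y hx hy => simp only [map_add, add_tmul, smul_add, hx, hy]
      | tmul w x => simp
  rw [h1, hz]
  clear hz h1
  induction z with
  | zero => simp
  | add x y hx hy => simp only [map_add, LinearMap.comp_add, LinearMap.rTensor_add,
      LinearMap.add_apply, hx, hy]
  | tmul w x =>
    have := congrArg (TensorProduct.mk k W A w) (hh.sum_smul_left hS (ℛ k x) (ℛ k y))
    rw [LinearMap.lTensor_tmul, ← (ℛ k x).eq, ← (ℛ k y).eq]
    simpa [tmul_sum, smul_tmul] using this

theorem coact_average (hS : ∀ a : A, S (S (S (S a))) = a)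
    (f : V →ₗ[k] W) (v : V) :
    coact k A W (average h f v) = (average h f).rTensor A (coact k A V v) := by
  have h1 : (average h f).rTensor A (coact k A V v) =
      (contract h W ∘ₗ (coact k A W ∘ₗ f).rTensor A).rTensor A
        ((coact k A V).rTensor A (coact k A V v)) := by
    simp only [average, LinearMap.rTensor_comp, LinearMap.comp_apply]
  have h2 := (RightComodule.coassoc v : TensorProduct.assoc k V A A ((coact k A V).rTensor A _) = _)
  rw [← LinearEquiv.eq_symm_apply] at h2
  rw [h1, h2]
  simp only [average, LinearMap.comp_apply]
  generalize coact k A V v = z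
  induction z with
  | zero => simp
  | add x y hx hy => simp only [map_add, hx, hy]
  | tmul v y =>
    simp only [LinearMap.rTensor_tmul, LinearMap.lTensor_tmul]
    rw [coact_contract hh hS _ _ (RightComodule.coassoc _), ← (ℛ k y).eq]
    simp [tmul_sum]

/-- Acting by `a` on `w ⊗ y` produces `h(S(a₂) w₁ a₄ S(a₅) S(y) S²(a₁)) w₀ · a₃`. The twisted trace
property brings `S²(a₁)` to the front as `a₁`, and then `a₁ S(a₂)` and `a₄ S(a₅)` cancel. -/
theorem contract_coact_twist (hS : ∀ a : A, S (S (S (S a))) = a)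
    (u : W ⊗[k] A) (a : A) :
    contract h W ((coact k A W).rTensor A
      (twist k A W ((comul (R := k) (A := A)).lTensor A (comul a)) u)) =
    op a • contract h W ((coact k A W).rTensor A u) := by
  induction u with
  | zero => simp
  | add x y hx hy => simp only [map_add, smul_add, hx, hy]
  | tmul w y =>
    rw [lTensor_comul_comul (ℛ k a)]
    simp only [map_sum, LinearMap.sum_apply, twist_tmul, LinearMap.rTensor_tmul,
      YetterDrinfeld.coact_smul]
    generalize coact k A W w = z
    induction z with
    | zero => simp
    | add x y hx hy => simp only [map_add, add_tmul, smul_add, Finset.sum_add_distrib, hx, hy]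
    | tmul w x =>
      let G : A ⊗[k] (A ⊗[k] A) →ₗ[k] W :=
        (TensorProduct.rid k W).toLinearMap ∘ₗ TensorProduct.map ((ract k A W).flip w)
          (h ∘ₗ LinearMap.mulRight k (S y) ∘ₗ LinearMap.mul' k A ∘ₗ
            (LinearMap.mulRight k x).rTensor A) ∘ₗ (TensorProduct.leftComm k A A A).toLinearMap
      have hG (p q r : A) : G (p ⊗ₜ (q ⊗ₜ r)) = h (p * x * r * S y) • op q • w := by
        simp [G, ract]
      have := congrArg G (sum_mul_antipode_tmul a)
      simp only [map_sum, hG] at this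
      simp only [lTensor_comul_comul (ℛ k _), map_sum, LinearMap.sum_apply, twist_tmul, sum_tmul,
        contract_tmul]
      simp only [one_mul, mul_one] at this
      rw [show op a • h (x * S y) • w = h (x * S y) • op a • w from
        (ract k A W a).map_smul _ w, ← this]
      refine Finset.sum_congr rfl fun i _ => Finset.sum_congr rfl fun l _ =>
        Finset.sum_congr rfl fun m _ => Finset.sum_congr rfl fun n _ => ?_
      congr 1
      simp only [antipode_mul_antidistrib]
      conv_rhs => rw [mul_assoc, mul_assoc, mul_assoc, hh.apply_mul_comm hS]
      simp only [mul_assoc]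

theorem average_smul (hS : ∀ a : A, S (S (S (S a))) = a)
    (f : V →ₗ[Aᵐᵒᵖ] W) (v : V) (a : A) :
    average h (f.restrictScalars k) (op a • v) = op a • average h (f.restrictScalars k) v := by
  simp only [average, LinearMap.comp_apply]
  rw [YetterDrinfeld.coact_smul, tens_twist, contract_coact_twist hh hS]

end Average


/-! ### Free Yetter-Drinfeld modules -/

section Twist

open Coalgebra HopfAlgebra WithConv

variable {k A : Type*} [Field k] [Ring A] [HopfAlgebra k A]
variable {V W : Type*} [AddCommGroup V] [Module k V] [Module Aᵐᵒᵖ V] [IsScalarTower k Aᵐᵒᵖ V]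
  [AddCommGroup W] [Module k W] [Module Aᵐᵒᵖ W] [IsScalarTower k Aᵐᵒᵖ W]

local notation "S" => HopfAlgebra.antipode k

variable (k A V) in
/-- The operators `v ⊗ x ↦ v · a₂ ⊗ S(a₁) x a₃` on `V ⊗ A`. -/
def diag : A →ₗ[k] Module.End k (V ⊗[k] A) :=
  twist k A V ∘ₗ (comul (R := k) (A := A)).lTensor A ∘ₗ comul

theorem diag_tmul {ι : Type*} {a : A} (r : Repr k a ι) (v : V) (x : A) :
    diag k A V a (v ⊗ₜ x) = ∑ i ∈ r.index, ∑ l ∈ (ℛ k (r.right i)).index,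
      (op ((ℛ k (r.right i)).left l) • v) ⊗ₜ[k]
        (S (r.left i) * x * (ℛ k (r.right i)).right l) := by
  simp [diag, lTensor_comul_comul r]

theorem twist_mul (s t : A ⊗[k] (A ⊗[k] A)) (z : V ⊗[k] A) :
    twist k A V (s * t) z = twist k A V t (twist k A V s z) := by
  induction z with
  | zero => simp
  | add x y hx hy => simp only [map_add, hx, hy]
  | tmul v x =>
    induction s with
    | zero => simp
    | add s s' hs hs' => simp only [add_mul, map_add, LinearMap.add_apply, hs, hs']
    | tmul a s =>
      induction s with
      | zero => simp
      | add s s' hs hs' => simp only [tmul_add, add_mul, map_add, LinearMap.add_apply, hs, hs']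
      | tmul b c =>
        induction t with
        | zero => simp
        | add s s' hs hs' => simp only [mul_add, map_add, LinearMap.add_apply, hs, hs']
        | tmul a' t =>
          induction t with
          | zero => simp
          | add s s' hs hs' => simp only [tmul_add, mul_add, map_add, LinearMap.add_apply, hs, hs']
          | tmul b' c' => simp [antipode_mul_antidistrib, mul_smul, mul_assoc]

theorem diag_mul (a b : A) (z : V ⊗[k] A) :
    diag k A V (a * b) z = diag k A V b (diag k A V a z) := by
  have h (t : A ⊗[k] A) : (comul (R := k) (A := A)).lTensor A t =
      Algebra.TensorProduct.map (AlgHom.id k A) (Bialgebra.comulAlgHom k A) t := rfl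
  simp only [diag, LinearMap.comp_apply, ← twist_mul, h, Bialgebra.comul_mul, map_mul]

theorem diag_one (z : V ⊗[k] A) : diag k A V 1 z = z := by
  simp only [diag, LinearMap.comp_apply, Bialgebra.comul_one, Algebra.TensorProduct.one_def,
    LinearMap.lTensor_tmul]
  induction z with
  | zero => simp
  | add x y hx hy => simp only [map_add, hx, hy]
  | tmul v x => simp

theorem rid_counit_diag (a : A) (z : V ⊗[k] A) :
    TensorProduct.rid k V ((counit (R := k) (A := A)).lTensor V (diag k A V a z)) =
      op a • TensorProduct.rid k V ((counit (R := k) (A := A)).lTensor V z) := by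
  induction z with
  | zero => simp
  | add x y hx hy => simp only [map_add, smul_add, hx, hy]
  | tmul v x =>
    -- The two convolution units are the factors `ε(S(a₁)) = ε(a₁)` and `ε(a₃)` left after applying
    -- `ε` to `S(a₁) x a₃`.
    have := congrArg (fun f : WithConv (A →ₗ[k] Module.End k V) => f.ofConv a v)
      (show 1 * (toConv (ract k A V) * 1) = toConv (ract k A V) by rw [one_mul, mul_one])
    simp only [Repr.convMul_apply (ℛ k _)] at this
    rw [diag_tmul (ℛ k a), LinearMap.lTensor_tmul, TensorProduct.rid_tmul,
      show op a • counit (R := k) x • v = counit (R := k) x • op a • v from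
        (ract k A V a).map_smul _ v, show op a • v = ract k A V a v from rfl, ← this]
    simp [Finset.mul_sum, Finset.smul_sum, ract, Algebra.algebraMap_eq_smul_one, smul_smul, mul_comm,
      mul_left_comm]

section Iterated

variable (k A V)

/-- Left multiplication by `S(a)` on the first copy of `A` in `V ⊗ (A ⊗ A)`. -/
def mulLeftFst : A →ₗ[k] Module.End k (V ⊗[k] (A ⊗[k] A)) :=
  LinearMap.lTensorHom V ∘ₗ LinearMap.rTensorHom A ∘ₗ LinearMap.mul k A ∘ₗ S

/-- Left multiplication by `S(a)` on the second copy of `A` in `V ⊗ (A ⊗ A)`. -/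
def mulLeftSnd : A →ₗ[k] Module.End k (V ⊗[k] (A ⊗[k] A)) :=
  LinearMap.lTensorHom V ∘ₗ LinearMap.lTensorHom A ∘ₗ LinearMap.mul k A ∘ₗ S

/-- Right multiplication by `a` on the first copy of `A` in `V ⊗ (A ⊗ A)`. -/
def mulRightFst : A →ₗ[k] Module.End k (V ⊗[k] (A ⊗[k] A)) :=
  LinearMap.lTensorHom V ∘ₗ LinearMap.rTensorHom A ∘ₗ (LinearMap.mul k A).flip

/-- Right multiplication by `a` on the second copy of `A` in `V ⊗ (A ⊗ A)`. -/
def mulRightSnd : A →ₗ[k] Module.End k (V ⊗[k] (A ⊗[k] A)) :=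
  LinearMap.lTensorHom V ∘ₗ LinearMap.lTensorHom A ∘ₗ (LinearMap.mul k A).flip

/-- The action of `a` on `V` in `V ⊗ (A ⊗ A)`. -/
def ractFst : A →ₗ[k] Module.End k (V ⊗[k] (A ⊗[k] A)) :=
  LinearMap.rTensorHom (A ⊗[k] A) ∘ₗ ract k A V

/-- The operators `v ⊗ (x ⊗ y) ↦ v · a₃ ⊗ (S(a₂) x a₄ ⊗ S(a₁) y a₅)`. -/
def diag₂ : WithConv (A →ₗ[k] Module.End k (V ⊗[k] (A ⊗[k] A))) :=
  toConv (mulLeftSnd k A V) * (toConv (mulLeftFst k A V) * (toConv (ractFst k A V) *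
    (toConv (mulRightFst k A V) * toConv (mulRightSnd k A V))))

end Iterated

/-- Together with `lTensor_comul_diag`, this shows that both sides of coassociativity intertwine
`diag` with the same five-factor operator `diag₂`. The two computations differ only in how the
convolution product is bracketed, so coassociativity need only be checked on module generators. -/
theorem assoc_rTensor_diag {c : V →ₗ[k] V ⊗[k] A} (hc : ∀ v a, c (op a • v) = diag k A V a (c v))
    (a : A) (z : V ⊗[k] A) :
    TensorProduct.assoc k V A A (c.rTensor A (diag k A V a z)) =
      (diag₂ k A V).ofConv a (TensorProduct.assoc k V A A (c.rTensor A z)) := by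
  induction z with
  | zero => simp
  | add x y hx hy => simp only [map_add, hx, hy]
  | tmul v y =>
    rw [diag_tmul (ℛ k a)]
    simp only [map_sum, LinearMap.rTensor_tmul, hc]
    generalize c v = z
    induction z with
    | zero => simp
    | add x y hx hy => simp only [map_add, add_tmul, Finset.sum_add_distrib, hx, hy]
    | tmul v x =>
      have : diag₂ k A V = toConv (mulLeftSnd k A V) * ((toConv (mulLeftFst k A V) *
          (toConv (ractFst k A V) * toConv (mulRightFst k A V))) *
            toConv (mulRightSnd k A V)) := by
        simp only [diag₂, mul_assoc]
      rw [this]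
      simp only [Repr.convMul_apply (ℛ k _), diag_tmul (ℛ k _)]
      simp [mulLeftFst, mulLeftSnd, mulRightFst, mulRightSnd, ractFst, ract, sum_tmul,
        Finset.mul_sum, Finset.sum_mul, mul_assoc]

theorem lTensor_comul_diag (a : A) (z : V ⊗[k] A) :
    (comul (R := k) (A := A)).lTensor V (diag k A V a z) =
      (diag₂ k A V).ofConv a ((comul (R := k) (A := A)).lTensor V z) := by
  induction z with
  | zero => simp
  | add x y hx hy => simp only [map_add, hx, hy]
  | tmul v y =>
    have : diag₂ k A V = (toConv (mulLeftSnd k A V) * toConv (mulLeftFst k A V)) *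
          (toConv (ractFst k A V) * (toConv (mulRightFst k A V) *
            toConv (mulRightSnd k A V))) := by
      simp only [diag₂, mul_assoc]
    rw [this, diag_tmul (ℛ k a)]
    rw [(ℛ k a).convMul_apply, LinearMap.sum_apply, map_sum]
    refine Finset.sum_congr rfl fun i _ => ?_
    rw [Module.End.mul_apply, (ℛ k ((ℛ k a).right i)).convMul_apply, LinearMap.sum_apply, map_sum,
      map_sum]
    refine Finset.sum_congr rfl fun l _ => ?_
    simp only [Repr.convMul_apply (ℛ k _), LinearMap.lTensor_tmul, Bialgebra.comul_mul]
    rw [← (reprAntipode (ℛ k ((ℛ k a).left i))).eq,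
      ← (ℛ k ((ℛ k ((ℛ k a).right i)).right l)).eq]
    generalize comul (R := k) y = u
    induction u with
    | zero => simp
    | add x y hx hy => simp only [map_add, tmul_add, mul_add, add_mul, hx, hy]
    | tmul x y =>
      simp [reprAntipode, mulLeftFst, mulLeftSnd, mulRightFst, mulRightSnd, ractFst, ract, tmul_sum,
        Finset.mul_sum, Finset.sum_mul, mul_assoc]

end Twist


/-! ### The free Yetter-Drinfeld module on a comodule -/

section Free

open Coalgebra HopfAlgebra

/-- The carrier `V ⊗ A` of the free Yetter-Drinfeld module on a comodule `V`. -/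
def FreeYD (k A V : Type*) [Field k] [Ring A] [Algebra k A] [AddCommGroup V] [Module k V] :=
  V ⊗[k] A

section Module

variable (k A V : Type*) [Field k] [Ring A] [Algebra k A] [AddCommGroup V] [Module k V]

instance : AddCommGroup (FreeYD k A V) := inferInstanceAs (AddCommGroup (V ⊗[k] A))

instance : Module k (FreeYD k A V) := inferInstanceAs (Module k (V ⊗[k] A))

/-- Right multiplication on the free Yetter-Drinfeld module. -/
def freeAct : Aᵐᵒᵖ →ₐ[k] Module.End k (FreeYD k A V) :=
  (Module.End.lTensorAlgHom k A V).comp (Algebra.lsmul k k A)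

instance : Module Aᵐᵒᵖ (FreeYD k A V) := Module.compHom _ (freeAct k A V).toRingHom

instance : IsScalarTower k Aᵐᵒᵖ (FreeYD k A V) where
  smul_assoc c a x := LinearMap.congr_fun (map_smul (freeAct k A V) c a) x

variable {k A V}

/-- The pure tensors. -/
def FreeYD.mk (v : V) (a : A) : FreeYD k A V := v ⊗ₜ[k] a

variable (k A V) in
/-- The inclusion of the generators. -/
def freeIncl : V →ₗ[k] FreeYD k A V := (TensorProduct.mk k V A).flip 1

theorem op_smul_freeIncl (a : A) (v : V) :
    op a • freeIncl k A V v = FreeYD.mk v a := by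
  change v ⊗ₜ[k] ((1 : A) * a) = v ⊗ₜ[k] a
  rw [one_mul]

theorem FreeYD.induction {p : FreeYD k A V → Prop} (zero : p 0)
    (smul : ∀ (a : A) (v : V), p (op a • freeIncl k A V v))
    (add : ∀ x y, p x → p y → p (x + y)) (x : FreeYD k A V) : p x :=
  TensorProduct.induction_on (motive := p) x zero
    (fun v a => by
      change p (FreeYD.mk v a)
      rw [← op_smul_freeIncl]
      exact smul a v) add

end Module

variable {k A V : Type*} [Field k] [Ring A] [HopfAlgebra k A] [AddCommGroup V] [Module k V]
  [RightComodule k A V]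

variable (k A V) in
/-- The coaction on the free Yetter-Drinfeld module. -/
def freeCoact : FreeYD k A V →ₗ[k] FreeYD k A V ⊗[k] A :=
  TensorProduct.lift ((diag k A (FreeYD k A V)).flip ∘ₗ (freeIncl k A V).rTensor A ∘ₗ
    RightComodule.coact (A := A))

theorem freeCoact_smul_freeIncl (a : A) (v : V) :
    freeCoact k A V (op a • freeIncl k A V v) = diag k A (FreeYD k A V) a
      ((freeIncl k A V).rTensor A (RightComodule.coact (A := A) v)) := by
  rw [op_smul_freeIncl]
  rfl

theorem freeCoact_freeIncl (v : V) : freeCoact k A V (freeIncl k A V v) =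
    (freeIncl k A V).rTensor A (RightComodule.coact (A := A) v) := by
  rw [← one_smul Aᵐᵒᵖ (freeIncl k A V v), ← op_one, freeCoact_smul_freeIncl, diag_one]

theorem freeCoact_smul (x : FreeYD k A V) (a : A) :
    freeCoact k A V (op a • x) = diag k A (FreeYD k A V) a (freeCoact k A V x) := by
  induction x using FreeYD.induction with
  | zero => simp
  | smul b v =>
    rw [← mul_smul, ← op_mul, freeCoact_smul_freeIncl, freeCoact_smul_freeIncl, diag_mul]
  | add x y hx hy => rw [smul_add, map_add, map_add, map_add, hx, hy]

/-- The coaction is compatible with the action by construction, and the other two axioms are stable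
under the action. On the generators `v ⊗ 1` they are the comodule axioms of `V`. -/
theorem freeCoact_axioms (x : FreeYD k A V) : AxiomsAt (freeCoact k A V) x := by
  refine FreeYD.induction ?_ (fun a v => ⟨?_, ?_, fun b => freeCoact_smul _ _⟩)
    (fun x y hx hy => hx.add hy) x
  · exact ⟨by simp, by simp, fun _ => by simp⟩
  · rw [freeCoact_smul, assoc_rTensor_diag freeCoact_smul, lTensor_comul_diag, freeCoact_freeIncl,
      rTensor_rTensor_coact (freeIncl k A V) freeCoact_freeIncl, assoc_rTensor,
      RightComodule.coassoc, lTensor_rTensor]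
  · rw [freeCoact_smul, rid_counit_diag, freeCoact_freeIncl, rid_lTensor, RightComodule.counit]

instance : YetterDrinfeld k A (FreeYD k A V) := ofAxioms (freeCoact k A V) freeCoact_axioms

end Free

/-! ### The canonical map from the free module onto a Yetter-Drinfeld module -/

section Cover

variable {k A V : Type*} [Field k] [Ring A] [HopfAlgebra k A] [AddCommGroup V] [Module k V]
  [Module Aᵐᵒᵖ V] [IsScalarTower k Aᵐᵒᵖ V]

variable (k A V) in
/-- The action, as a `k`-linear map on the free Yetter-Drinfeld module. -/
def freeCounitₗ : FreeYD k A V →ₗ[k] V := TensorProduct.lift (ract k A V).flip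

theorem freeCounitₗ_smul_freeIncl (a : A) (v : V) :
    freeCounitₗ k A V (op a • freeIncl k A V v) = op a • v := by
  rw [op_smul_freeIncl]
  rfl

variable (k A V) in
/-- The action, as a map on the free Yetter-Drinfeld module. -/
def freeCounit : FreeYD k A V →ₗ[Aᵐᵒᵖ] V where
  __ := freeCounitₗ k A V
  map_smul' b x := by
    obtain ⟨b, rfl⟩ := op_surjective b
    change freeCounitₗ k A V _ = op b • freeCounitₗ k A V x
    induction x using FreeYD.induction with
    | zero => simp
    | smul a v =>
      rw [← mul_smul, ← op_mul, freeCounitₗ_smul_freeIncl, freeCounitₗ_smul_freeIncl, op_mul,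
        mul_smul]
    | add x y hx hy => rw [smul_add, map_add, map_add, smul_add, hx, hy]

theorem freeCounit_freeIncl (v : V) : freeCounit k A V (freeIncl k A V v) = v := by
  rw [← one_smul Aᵐᵒᵖ (freeIncl k A V v), ← op_one]
  exact (freeCounitₗ_smul_freeIncl 1 v).trans (by simp)

theorem coact_freeCounit [YetterDrinfeld k A V] (x : FreeYD k A V) :
    coact k A V (freeCounit k A V x) =
      tens k A (freeCounit k A V) (coact k A (FreeYD k A V) x) := by
  induction x using FreeYD.induction with
  | zero => simp
  | smul a v =>
    rw [map_smul, freeCounit_freeIncl, YetterDrinfeld.coact_smul, YetterDrinfeld.coact_smul,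
      tens_twist]
    congr 1
    change _ = tens k A (freeCounit k A V) (freeCoact k A V (freeIncl k A V v))
    rw [freeCoact_freeIncl, ← LinearMap.comp_apply, ← LinearMap.rTensor_comp,
      show (freeCounit k A V).restrictScalars k ∘ₗ freeIncl k A V = LinearMap.id from
        LinearMap.ext freeCounit_freeIncl, LinearMap.rTensor_id, LinearMap.id_apply]
  | add x y hx hy => simp only [map_add, hx, hy]

end Cover

namespace YDCat

variable {k A : Type u} [Field k] [Ring A] [HopfAlgebra k A]

/-- The free Yetter-Drinfeld module on the underlying comodule of `V`. -/
def free (V : YDCat k A) : YDCat k A := of (FreeYD k A V)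

/-- The canonical epimorphism from the free Yetter-Drinfeld module. -/
def freeπ (V : YDCat k A) : free V ⟶ V := ⟨freeCounit k A V, coact_freeCounit⟩

theorem freeπ_surjective (V : YDCat k A) : Function.Surjective (lin (freeπ V)) :=
  fun v => ⟨freeIncl k A V v, freeCounit_freeIncl v⟩

end YDCat


/-! ### The bimodule `A ⊗ V` of a right module `V` -/

section Bimodule

open Coalgebra HopfAlgebra WithConv

/-- The carrier `A ⊗ V` of the bimodule of a right module `V`, with
`a · (x ⊗ v) · b = a x b₁ ⊗ v · b₂`. -/
def TensorBimodule (k A V : Type*) [Field k] [Ring A] [Algebra k A] [AddCommGroup V] [Module k V] :=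
  A ⊗[k] V

section Module

variable (k A V : Type*) [Field k] [Ring A] [AddCommGroup V] [Module k V]

instance [Algebra k A] : AddCommGroup (TensorBimodule k A V) :=
  inferInstanceAs (AddCommGroup (A ⊗[k] V))

instance [Algebra k A] : Module k (TensorBimodule k A V) :=
  inferInstanceAs (Module k (A ⊗[k] V))

section

variable {k A V} [Algebra k A]

/-- The pure tensors of the bimodule `A ⊗ V`. -/
def TensorBimodule.mk : A →ₗ[k] V →ₗ[k] TensorBimodule k A V := TensorProduct.mk k A V

theorem TensorBimodule.induction {p : TensorBimodule k A V → Prop} (zero : p 0)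
    (mk : ∀ (a : A) (v : V), p (mk a v)) (add : ∀ x y, p x → p y → p (x + y))
    (x : TensorBimodule k A V) : p x :=
  TensorProduct.induction_on (motive := p) x zero mk add

end

variable [HopfAlgebra k A] [Module Aᵐᵒᵖ V] [IsScalarTower k Aᵐᵒᵖ V]

/-- The operators `x ⊗ v ↦ x a ⊗ v · b`, for `a ⊗ b` in `A ⊗ A`. -/
def rightMap : A ⊗[k] A →ₗ[k] Module.End k (A ⊗[k] V) :=
  TensorProduct.homTensorHomMap (RingHom.id k) A V A V ∘ₗ
    TensorProduct.map (LinearMap.mul k A).flip (ract k A V)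

variable {k A V} in
@[simp]
theorem rightMap_tmul (a b x : A) (v : V) :
    rightMap k A V (a ⊗ₜ b) (x ⊗ₜ v) = (x * a) ⊗ₜ (op b • v) := by
  simp [rightMap, ract]

variable {k A V} in
theorem rightMap_mul (s t : A ⊗[k] A) :
    rightMap k A V (s * t) = rightMap k A V t * rightMap k A V s := by
  induction s with
  | zero => simp
  | add x y hx hy => simp only [add_mul, mul_add, map_add, hx, hy]
  | tmul a b =>
    induction t with
    | zero => simp
    | add x y hx hy => simp only [add_mul, mul_add, map_add, hx, hy]
    | tmul c d =>
      refine TensorProduct.ext' fun x v => ?_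
      simp [mul_assoc, mul_smul]

/-- The left action on the bimodule `A ⊗ V`. -/
def bimoduleLeft : A →ₐ[k] Module.End k (A ⊗[k] V) :=
  (Module.End.rTensorAlgHom k A V).comp (Algebra.lmul k A)

variable {k A V} in
omit [Module Aᵐᵒᵖ V] [IsScalarTower k Aᵐᵒᵖ V] in
@[simp]
theorem bimoduleLeft_tmul (a x : A) (v : V) :
    bimoduleLeft k A V a (x ⊗ₜ v) = (a * x) ⊗ₜ v := rfl

/-- The right action on the bimodule `A ⊗ V`. -/
def bimoduleRight : Aᵐᵒᵖ →ₐ[k] Module.End k (A ⊗[k] V) :=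
  AlgHom.ofLinearMap (rightMap k A V ∘ₗ comul ∘ₗ (opLinearEquiv k).symm.toLinearMap)
    (TensorProduct.ext' fun x v => by simp [Algebra.TensorProduct.one_def])
    (fun x y => by simp [rightMap_mul])

/-- The action of `A ⊗ Aᵐᵒᵖ` on `A ⊗ V`. -/
def bimoduleAct : A ⊗[k] Aᵐᵒᵖ →ₐ[k] Module.End k (A ⊗[k] V) :=
  Algebra.TensorProduct.lift (bimoduleLeft k A V) (bimoduleRight k A V) fun a b => by
    obtain ⟨b, rfl⟩ := op_surjective b
    have (t : A ⊗[k] A) : Commute (bimoduleLeft k A V a) (rightMap k A V t) := by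
      induction t with
      | zero => simp
      | add x y hx hy => rw [map_add]; exact hx.add_right hy
      | tmul c d =>
        refine TensorProduct.ext' fun x v => ?_
        simp [mul_assoc]
    exact this _

instance : Module (A ⊗[k] Aᵐᵒᵖ) (TensorBimodule k A V) :=
  Module.compHom (A ⊗[k] V) (bimoduleAct k A V).toRingHom

instance : IsScalarTower k (A ⊗[k] Aᵐᵒᵖ) (TensorBimodule k A V) where
  smul_assoc c a x := LinearMap.congr_fun (map_smul (bimoduleAct k A V) c a) x

variable {k A V}

theorem TensorBimodule.smul_mk {ι : Type*} (a b x : A) (v : V) (r : Repr k b ι) :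
    (a ⊗ₜ[k] op b) • (mk x v : TensorBimodule k A V) =
      ∑ i ∈ r.index, mk (a * x * r.left i) (op (r.right i) • v) := by
  change bimoduleLeft k A V a (rightMap k A V (comul b) (x ⊗ₜ v)) = _
  rw [← r.eq]
  simp [mul_assoc]
  rfl

end Module

variable {k A V W : Type*} [Field k] [Ring A] [HopfAlgebra k A]
  [AddCommGroup V] [Module k V] [Module Aᵐᵒᵖ V] [IsScalarTower k Aᵐᵒᵖ V]
  [AddCommGroup W] [Module k W] [Module Aᵐᵒᵖ W] [IsScalarTower k Aᵐᵒᵖ W]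

/-- Linear maps between bimodules, from compatibility with pure tensors. -/
def bimoduleHom {M N : Type*} [AddCommGroup M] [AddCommGroup N] [Module k M] [Module k N]
    [Module (A ⊗[k] Aᵐᵒᵖ) M] [Module (A ⊗[k] Aᵐᵒᵖ) N] (f : M →ₗ[k] N)
    (hf : ∀ (a b : A) (x : M), f ((a ⊗ₜ[k] op b) • x) = (a ⊗ₜ[k] op b) • f x) :
    M →ₗ[A ⊗[k] Aᵐᵒᵖ] N where
  __ := f
  map_smul' r x := by
    change f (r • x) = r • f x
    induction r with
    | zero =>
      exact (congrArg f (zero_smul (A ⊗[k] Aᵐᵒᵖ) x)).trans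
        ((map_zero f).trans (zero_smul (A ⊗[k] Aᵐᵒᵖ) (f x)).symm)
    | add r s hr hs => simp only [add_smul, map_add, hr, hs]
    | tmul a b => exact hf a (unop b) x

/-- Functoriality of the bimodule `A ⊗ V`, for `k`-linear maps. -/
def TensorBimodule.mapₗ (f : V →ₗ[k] W) : TensorBimodule k A V →ₗ[k] TensorBimodule k A W :=
  f.lTensor A

omit [Module Aᵐᵒᵖ V] [IsScalarTower k Aᵐᵒᵖ V] [Module Aᵐᵒᵖ W] [IsScalarTower k Aᵐᵒᵖ W] in
theorem TensorBimodule.mapₗ_mk (f : V →ₗ[k] W) (x : A) (v : V) :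
    mapₗ f (mk x v) = mk x (f v) := rfl

/-- Functoriality of the bimodule `A ⊗ V`. -/
def TensorBimodule.map (f : V →ₗ[Aᵐᵒᵖ] W) :
    TensorBimodule k A V →ₗ[A ⊗[k] Aᵐᵒᵖ] TensorBimodule k A W :=
  bimoduleHom (mapₗ (f.restrictScalars k)) fun a b x => by
    induction x using TensorBimodule.induction with
    | zero => simp
    | add x y hx hy => simp only [smul_add, map_add, hx, hy]
    | mk x v =>
      rw [smul_mk a b x v (ℛ k b), map_sum, mapₗ_mk, smul_mk a b x _ (ℛ k b)]
      simp only [mapₗ_mk, LinearMap.restrictScalars_apply, map_smul]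

@[simp]
theorem TensorBimodule.map_mk (f : V →ₗ[Aᵐᵒᵖ] W) (x : A) (v : V) :
    map (k := k) f (mk x v) = mk x (f v) := rfl

variable (k A V) in
/-- The map `ε ⊗ id`. -/
def TensorBimodule.counitMap : TensorBimodule k A V →ₗ[k] V :=
  (TensorProduct.lid k V).toLinearMap ∘ₗ (counit (R := k) (A := A)).rTensor V

omit [Module Aᵐᵒᵖ V] [IsScalarTower k Aᵐᵒᵖ V] in
@[simp]
theorem TensorBimodule.counitMap_mk (x : A) (v : V) :
    counitMap k A V (mk x v) = counit (R := k) x • v := rfl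

theorem TensorBimodule.counitMap_map (f : V →ₗ[Aᵐᵒᵖ] W) (x : TensorBimodule k A V) :
    counitMap k A W (map f x) = f (counitMap k A V x) := by
  induction x using TensorBimodule.induction with
  | zero => simp
  | add x y hx hy => simp only [map_add, hx, hy]
  | mk x v => simp only [map_mk, counitMap_mk]; exact ((f.restrictScalars k).map_smul _ v).symm

/-- Thus `ε ⊗ id` is right linear and trivializes the left action, which is why bimodule maps
descend to right module maps. -/
theorem TensorBimodule.counitMap_smul (a b : A) (x : TensorBimodule k A V) :
    counitMap k A V ((a ⊗ₜ[k] op b) • x) = counit (R := k) a • op b • counitMap k A V x := by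
  induction x using TensorBimodule.induction with
  | zero => simp
  | add x y hx hy => simp only [smul_add, map_add, hx, hy]
  | mk x v =>
    rw [smul_mk a b x v (ℛ k b), map_sum]
    have h := congrArg (fun b => ract k A V b v) (sum_counit_smul (ℛ k b))
    simp only [map_sum, map_smul, LinearMap.sum_apply, LinearMap.smul_apply] at h
    rw [counitMap_mk, show op b • counit (R := k) x • v = counit (R := k) x • op b • v from
        (ract k A V b).map_smul _ v, show op b • v = ract k A V b v from rfl, ← h]
    simp [Finset.smul_sum, smul_smul, mul_assoc, ract]

/-- A bimodule map `A ⊗ V → A ⊗ W` induces a right module map `V → W`. -/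
def TensorBimodule.descend (s : TensorBimodule k A V →ₗ[A ⊗[k] Aᵐᵒᵖ] TensorBimodule k A W) :
    V →ₗ[Aᵐᵒᵖ] W where
  toFun v := counitMap k A W (s (mk 1 v))
  map_add' := by simp
  map_smul' b v := by
    obtain ⟨b, rfl⟩ := op_surjective b
    -- Left linearity of `s` gives the factor `ε(x)`. Right linearity (`h2`) then gives `ε(b₁)`
    -- times the value at `v · b₂`, and the counit axiom sums these to the value at `v · b`.
    have h1 (x : A) (v : V) : counitMap k A W (s (mk x v)) =
        counit (R := k) x • counitMap k A W (s (mk 1 v)) := by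
      have := counitMap_smul x 1 (s (mk 1 v))
      rw [← map_smul, smul_mk x 1 1 v ⟨{()}, fun _ => 1, fun _ => 1, by
        simp [Algebra.TensorProduct.one_def]⟩] at this
      simpa using this
    have h2 := counitMap_smul 1 b (s (mk 1 v))
    rw [← map_smul, smul_mk 1 b 1 v (ℛ k b)] at h2
    rw [map_sum, map_sum, Finset.sum_congr rfl fun i _ => h1 _ _] at h2
    simp only [one_mul, Bialgebra.counit_one, one_smul] at h2
    rw [RingHom.id_apply, ← h2]
    have h3 := congrArg ((counitMap k A W ∘ₗ s.restrictScalars k ∘ₗ mk 1) ∘ₗ (ract k A V).flip v)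
      (sum_counit_smul (ℛ k b))
    rw [map_sum] at h3
    simpa [ract] using h3.symm

end Bimodule


/-! ### The bimodule of a free Yetter-Drinfeld module is free -/

section Projective

open Coalgebra HopfAlgebra WithConv

variable {k A V : Type*} [Field k] [Ring A] [HopfAlgebra k A] [AddCommGroup V] [Module k V]

local notation "S" => HopfAlgebra.antipode k

theorem sum_antipode_mul_tmul (b : A) :
    ∑ i ∈ (ℛ k b).index, ∑ l ∈ (ℛ k ((ℛ k b).right i)).index,
      (S ((ℛ k b).left i) * (ℛ k ((ℛ k b).right i)).left l) ⊗ₜ[k]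
        (ℛ k ((ℛ k b).right i)).right l = 1 ⊗ₜ[k] b := by
  let j₁ : A →ₐ[k] A ⊗[k] A := Algebra.TensorProduct.includeLeft
  let j₂ : A →ₐ[k] A ⊗[k] A := Algebra.TensorProduct.includeRight
  have key : toConv (j₁.toLinearMap ∘ₗ S) * (toConv j₁.toLinearMap * toConv j₂.toLinearMap) =
      toConv j₂.toLinearMap := by
    rw [← mul_assoc, antipode_convMul_algHom, one_mul]
  have := congrArg (fun f : WithConv (A →ₗ[k] A ⊗[k] A) => f.ofConv b) key
  simp only [Repr.convMul_apply (ℛ k _)] at this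
  simpa [j₁, j₂, Finset.mul_sum] using this

theorem sum_mul_antipode_tmul_right (b : A) :
    ∑ i ∈ (ℛ k b).index, ∑ l ∈ (ℛ k ((ℛ k b).right i)).index,
      ((ℛ k b).left i * S ((ℛ k ((ℛ k b).right i)).left l)) ⊗ₜ[k]
        (ℛ k ((ℛ k b).right i)).right l = 1 ⊗ₜ[k] b := by
  let j₁ : A →ₐ[k] A ⊗[k] A := Algebra.TensorProduct.includeLeft
  let j₂ : A →ₐ[k] A ⊗[k] A := Algebra.TensorProduct.includeRight
  have key : toConv j₁.toLinearMap * (toConv (j₁.toLinearMap ∘ₗ S) * toConv j₂.toLinearMap) =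
      toConv j₂.toLinearMap := by
    rw [← mul_assoc, algHom_convMul_antipode, one_mul]
  have := congrArg (fun f : WithConv (A →ₗ[k] A ⊗[k] A) => f.ofConv b) key
  simp only [Repr.convMul_apply (ℛ k _)] at this
  simpa [j₁, j₂, Finset.mul_sum] using this

namespace TensorBimodule

variable (k A V) in
/-- The bimodule map `(A ⊗ Aᵐᵒᵖ) ⊗ V → A ⊗ (V ⊗ A)` sending `1 ⊗ v` to `1 ⊗ (v ⊗ 1)`. -/
def ofFree : (A ⊗[k] Aᵐᵒᵖ) ⊗[k] V →ₗ[A ⊗[k] Aᵐᵒᵖ] TensorBimodule k A (FreeYD k A V) :=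
  TensorProduct.AlgebraTensorModule.lift
    (LinearMap.toSpanSingleton (A ⊗[k] Aᵐᵒᵖ) (V →ₗ[k] TensorBimodule k A (FreeYD k A V))
      (mk 1 ∘ₗ freeIncl k A V))

theorem ofFree_tmul (a b : A) (v : V) {ι : Type*} (r : Repr k b ι) :
    ofFree k A V ((a ⊗ₜ op b) ⊗ₜ v) =
      ∑ i ∈ r.index, mk (a * r.left i) (op (r.right i) • freeIncl k A V v) := by
  change (a ⊗ₜ[k] op b) • (mk 1 (freeIncl k A V v) : TensorBimodule k A (FreeYD k A V)) = _
  rw [smul_mk a b 1 _ r]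
  simp only [mul_one]

variable (k A V) in
/-- The inverse `a ⊗ (v ⊗ b) ↦ (a S(b₁) ⊗ b₂) ⊗ v` of `ofFree`. -/
def toFree : TensorBimodule k A (FreeYD k A V) →ₗ[k] (A ⊗[k] Aᵐᵒᵖ) ⊗[k] V :=
  (TensorProduct.comm k V (A ⊗[k] Aᵐᵒᵖ)).toLinearMap ∘ₗ
    (TensorProduct.map (LinearMap.mul' k A ∘ₗ (antipode k).lTensor A)
      (opLinearEquiv k : A ≃ₗ[k] Aᵐᵒᵖ).toLinearMap ∘ₗ
      (TensorProduct.assoc k A A A).symm.toLinearMap ∘ₗ comul.lTensor A).lTensor V ∘ₗ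
    (TensorProduct.leftComm k A V A).toLinearMap

theorem toFree_mk (a b : A) (v : V) {ι : Type*} (r : Repr k b ι) :
    toFree k A V (mk a (op b • freeIncl k A V v)) =
      ∑ i ∈ r.index, ((a * S (r.left i)) ⊗ₜ op (r.right i)) ⊗ₜ v := by
  rw [op_smul_freeIncl]
  have : toFree k A V (mk a (FreeYD.mk v b)) = TensorProduct.comm k V (A ⊗[k] Aᵐᵒᵖ)
    (v ⊗ₜ TensorProduct.map (LinearMap.mul' k A ∘ₗ (antipode k).lTensor A)
      (opLinearEquiv k : A ≃ₗ[k] Aᵐᵒᵖ).toLinearMap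
        ((TensorProduct.assoc k A A A).symm (a ⊗ₜ comul b))) := rfl
  rw [this, ← r.eq]
  simp [tmul_sum]

theorem toFree_ofFree (x : (A ⊗[k] Aᵐᵒᵖ) ⊗[k] V) : toFree k A V (ofFree k A V x) = x := by
  induction x with
  | zero => simp
  | add x y hx hy => simp only [map_add, hx, hy]
  | tmul r v =>
    induction r with
    | zero => simp
    | add x y hx hy => simp only [add_tmul, map_add, hx, hy]
    | tmul a b =>
      obtain ⟨b, rfl⟩ := op_surjective b
      rw [ofFree_tmul a b v (ℛ k b), map_sum,
        Finset.sum_congr rfl fun i _ => toFree_mk _ _ v (ℛ k ((ℛ k b).right i))]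
      have := congrArg (fun t => (TensorProduct.map (LinearMap.mulLeft k a)
        (opLinearEquiv k : A ≃ₗ[k] Aᵐᵒᵖ).toLinearMap t) ⊗ₜ[k] v) (sum_mul_antipode_tmul_right b)
      simpa [sum_tmul, mul_assoc] using this

theorem ofFree_toFree (x : TensorBimodule k A (FreeYD k A V)) :
    ofFree k A V (toFree k A V x) = x := by
  induction x using TensorBimodule.induction with
  | zero => simp
  | add x y hx hy => simp only [map_add, hx, hy]
  | mk a x =>
    induction x using FreeYD.induction with
    | zero => simp
    | add x y hx hy => simp only [map_add, hx, hy]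
    | smul b v =>
      rw [toFree_mk a b v (ℛ k b), map_sum,
        Finset.sum_congr rfl fun i _ => ofFree_tmul _ _ v (ℛ k ((ℛ k b).right i))]
      have := congrArg (TensorProduct.lift ((mk (k := k) (A := A)
        (V := FreeYD k A V)).compl₁₂ (LinearMap.mulLeft k a) ((ract k A (FreeYD k A V)).flip
          (freeIncl k A V v)))) (sum_antipode_mul_tmul (k := k) b)
      simpa [ract, mul_assoc] using this

/-- Over a field `V` has a basis, so `(A ⊗ Aᵐᵒᵖ) ⊗ V` is a free module. The map `ofFree` is linear
over the enveloping algebra, and `toFree` is only needed to show that it is bijective. -/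
instance projective_free : Module.Projective (A ⊗[k] Aᵐᵒᵖ) (TensorBimodule k A (FreeYD k A V)) :=
  Module.Projective.of_equiv (LinearEquiv.ofBijective (ofFree k A V)
    ⟨(Function.LeftInverse.injective toFree_ofFree),
      Function.RightInverse.surjective ofFree_toFree⟩)

end TensorBimodule

end Projective

/-! ### The exact functor to bimodules, and reflection of projectivity -/

section Functor

namespace TensorBimodule

variable {k A V W Z : Type*} [Field k] [Ring A] [HopfAlgebra k A]
  [AddCommGroup V] [Module k V] [Module Aᵐᵒᵖ V] [IsScalarTower k Aᵐᵒᵖ V]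
  [AddCommGroup W] [Module k W] [Module Aᵐᵒᵖ W] [IsScalarTower k Aᵐᵒᵖ W]
  [AddCommGroup Z] [Module k Z] [Module Aᵐᵒᵖ Z] [IsScalarTower k Aᵐᵒᵖ Z]

theorem hom_ext {M : Type*} [AddCommGroup M] [Module (A ⊗[k] Aᵐᵒᵖ) M]
    {f g : TensorBimodule k A V →ₗ[A ⊗[k] Aᵐᵒᵖ] M} (h : ∀ x v, f (mk (k := k) x v) = g (mk x v)) :
    f = g := by
  ext x
  induction x using TensorBimodule.induction with
  | zero => simp
  | add x y hx hy => rw [map_add, map_add, hx, hy]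
  | mk x v => exact h x v

theorem map_id : map (k := k) (LinearMap.id : V →ₗ[Aᵐᵒᵖ] V) = LinearMap.id :=
  hom_ext fun _ _ => rfl

theorem map_comp (f : V →ₗ[Aᵐᵒᵖ] W) (g : W →ₗ[Aᵐᵒᵖ] Z) :
    map (k := k) (g ∘ₗ f) = map (k := k) g ∘ₗ map (k := k) f :=
  hom_ext fun _ _ => rfl

theorem map_add (f g : V →ₗ[Aᵐᵒᵖ] W) : map (k := k) (f + g) = map f + map g :=
  hom_ext fun x _ => _root_.map_add (mk x) _ _

theorem map_injective {f : V →ₗ[Aᵐᵒᵖ] W} (hf : Function.Injective f) :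
    Function.Injective (map (k := k) f) :=
  Module.Flat.lTensor_preserves_injective_linearMap (M := A) (f.restrictScalars k) hf

theorem map_surjective {f : V →ₗ[Aᵐᵒᵖ] W} (hf : Function.Surjective f) :
    Function.Surjective (map (k := k) f) :=
  LinearMap.lTensor_surjective A (g := f.restrictScalars k) hf

theorem map_exact {f : V →ₗ[Aᵐᵒᵖ] W} {g : W →ₗ[Aᵐᵒᵖ] Z} (h : Function.Exact f g) :
    Function.Exact (map (k := k) f) (map (k := k) g) :=
  Module.Flat.lTensor_exact A (f := f.restrictScalars k) (g := g.restrictScalars k) h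

theorem comp_descend {s : TensorBimodule k A V →ₗ[A ⊗[k] Aᵐᵒᵖ] TensorBimodule k A W}
    {e : W →ₗ[Aᵐᵒᵖ] Z} {f : V →ₗ[Aᵐᵒᵖ] Z} (h : map e ∘ₗ s = map f) : e ∘ₗ descend s = f := by
  ext v
  have := congrArg (counitMap k A Z) (LinearMap.congr_fun h (mk 1 v))
  rw [LinearMap.comp_apply, counitMap_map, map_mk, counitMap_mk, Bialgebra.counit_one,
    one_smul] at this
  exact this

end TensorBimodule

section Trivial

variable (k A : Type u) [Field k] [Ring A] [HopfAlgebra k A]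

/-- The map `a ⊗ c ↦ c a`. -/
def trivMap : TensorBimodule k A (Triv k A) →ₗ[k] A := (TensorProduct.rid k A).toLinearMap

variable {k A} in
theorem trivMap_mk (a : A) (c : Triv k A) :
    trivMap k A (TensorBimodule.mk a c) = (show k from c) • a := rfl

theorem trivMap_smul (a b : A) (x : TensorBimodule k A (Triv k A)) :
    trivMap k A ((a ⊗ₜ[k] op b) • x) = a * trivMap k A x * b := by
  induction x using TensorBimodule.induction with
  | zero => simp
  | add x y hx hy => rw [smul_add, map_add, map_add, hx, hy, mul_add, add_mul]
  | mk x c =>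
    let r := Coalgebra.Repr.arbitrary k b
    have h := congrArg (TensorProduct.rid k A) (Coalgebra.sum_tmul_counit_eq r)
    simp only [map_sum, TensorProduct.rid_tmul, one_smul] at h
    rw [TensorBimodule.smul_mk a b x c r, map_sum]
    conv_rhs => rw [← h]
    rw [Finset.mul_sum]
    refine Finset.sum_congr rfl fun i _ => ?_
    rw [trivMap_mk, trivMap_mk, Triv.op_smul, mul_smul_comm, mul_smul_comm, smul_mul_assoc, smul_smul]
    rfl

/-- The bimodule of the trivial module is the regular bimodule. -/
def trivEquiv : letI := instModuleTensorProductMop k A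
    TensorBimodule k A (Triv k A) ≃ₗ[A ⊗[k] Aᵐᵒᵖ] A :=
  letI := instModuleTensorProductMop k A
  LinearEquiv.ofBijective (bimoduleHom (trivMap k A) fun a b x => by
    rw [trivMap_smul]
    change _ = a * (trivMap k A x * b)
    rw [mul_assoc]) (TensorProduct.rid k A).bijective

end Trivial

variable (k A : Type u) [Field k] [Ring A] [HopfAlgebra k A]

/-- The functor `V ↦ A ⊗ V` from Yetter-Drinfeld modules to bimodules. -/
def bimoduleFunctor : YDCat k A ⥤ ModuleCat.{u} (A ⊗[k] Aᵐᵒᵖ) where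
  obj V := ModuleCat.of _ (TensorBimodule k A V)
  map f := ModuleCat.ofHom (TensorBimodule.map (YDCat.lin f))
  map_id _ := congrArg ModuleCat.ofHom TensorBimodule.map_id
  map_comp _ _ := congrArg ModuleCat.ofHom (TensorBimodule.map_comp _ _)

instance : (bimoduleFunctor k A).Additive where
  map_add {_ _ f g} := congrArg ModuleCat.ofHom
    (TensorBimodule.map_add (k := k) (YDCat.lin f) (YDCat.lin g))

variable {k A}

theorem YDCat.shortExact_free (V : YDCat k A) :
    (ShortComplex.mk (kerι (freeπ V)) (freeπ V) (kerι_comp _)).ShortExact where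
  exact := ShortComplex.exact_of_f_is_kernel _ (isLimitOfRange _ _ (kerι_injective _)
    (range_kerι _) _)
  mono_f := mono_of_injective _ (kerι_injective _)
  epi_g := epi_of_surjective _ (freeπ_surjective V)

theorem YDCat.shortExact_map_free (V : YDCat k A) :
    ((ShortComplex.mk (kerι (freeπ V)) (freeπ V) (kerι_comp _)).map
      (bimoduleFunctor k A)).ShortExact :=
  ModuleCat.shortComplex_shortExact _
    (TensorBimodule.map_exact (k := k) (LinearMap.exact_iff.2 (range_kerι (freeπ V)).symm))
    (TensorBimodule.map_injective (k := k) (kerι_injective (freeπ V)))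
    (TensorBimodule.map_surjective (k := k) (freeπ_surjective V))

instance (V : YDCat k A) : Projective ((bimoduleFunctor k A).obj (YDCat.free V)) :=
  (IsProjective.iff_projective (R := A ⊗[k] Aᵐᵒᵖ) (TensorBimodule k A (FreeYD k A V))).1 inferInstance

/-- The regular bimodule is the image of the trivial Yetter-Drinfeld module. -/
def bimoduleFunctorTrivial : (bimoduleFunctor k A).obj (trivialYD k A) ≅ regularBimodule k A :=
  letI := instModuleTensorProductMop k A
  (trivEquiv k A).toModuleIso

/-- A lift of bimodules descends to the `A`-linear lift `t`, and averaging makes it colinear. It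
remains a lift: averaging commutes with composition by the colinear `e` and fixes the colinear `f`.
-/
theorem projective_of_projective_bimoduleFunctor {h : A →ₗ[k] k} (hh : IsNormalizedIntegral h)
    (hS : ∀ a : A, HopfAlgebra.antipode k (HopfAlgebra.antipode k
      (HopfAlgebra.antipode k (HopfAlgebra.antipode k a))) = a)
    (P : YDCat k A) [Projective ((bimoduleFunctor k A).obj P)] : Projective P where
  factors {E B} f e _ := by
    have : Epi ((bimoduleFunctor k A).map e) := (ModuleCat.epi_iff_surjective _).2
      (TensorBimodule.map_surjective (k := k) (YDCat.surjective_of_epi e))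
    let s := Projective.factorThru ((bimoduleFunctor k A).map f) ((bimoduleFunctor k A).map e)
    let t : P →ₗ[Aᵐᵒᵖ] E := TensorBimodule.descend (k := k) s.hom
    have ht : YDCat.lin e ∘ₗ t = YDCat.lin f := TensorBimodule.comp_descend
      (congrArg ModuleCat.Hom.hom (Projective.factorThru_comp
        ((bimoduleFunctor k A).map f) ((bimoduleFunctor k A).map e)))
    let t' : P →ₗ[Aᵐᵒᵖ] E :=
      { average h (t.restrictScalars k) with
        map_smul' := fun b v => average_smul hh hS t v (unop b) }
    refine ⟨⟨t', coact_average hh hS (t.restrictScalars k)⟩, YDCat.hom_ext fun v => ?_⟩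
    have h1 := average_comp (h := h) ((YDCat.lin e).restrictScalars k) (YDCat.colinear e)
      (t.restrictScalars k)
    have h2 : (YDCat.lin e).restrictScalars k ∘ₗ t.restrictScalars k =
      (YDCat.lin f).restrictScalars k := LinearMap.ext fun v => LinearMap.congr_fun ht v
    rw [h2, average_of_colinear hh _ (YDCat.colinear f)] at h1
    exact (LinearMap.congr_fun h1 v).symm

end Functor

/-! ### Comparison of projective dimensions -/

section Dimension

universe v v' u₁ u₂ w w'

variable {C : Type u₁} [Category.{v} C] [Abelian C] {D : Type u₂} [Category.{v'} D] [Abelian D]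

/-- An additive functor `F` that reflects projective objects preserves and reflects projective
dimension, if every object `X` admits a presentation whose image under `F` is exact and
whose middle term has projective image. -/
theorem hasProjectiveDimensionLT_succ_iff_of_functor (F : C ⥤ D) [F.Additive]
    (h₁ : ∀ P, Projective (F.obj P) → Projective P)
    (h₂ : ∀ X, ∃ S : ShortComplex C, S.X₃ = X ∧ S.ShortExact ∧ (S.map F).ShortExact ∧
      Projective (F.obj S.X₂)) (n : ℕ) (X : C) :
    HasProjectiveDimensionLT X (n + 1) ↔ HasProjectiveDimensionLT (F.obj X) (n + 1) := by
  induction n generalizing X with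
  | zero =>
    rw [zero_add, ← projective_iff_hasProjectiveDimensionLT_one,
      ← projective_iff_hasProjectiveDimensionLT_one]
    -- If `X` is projective its presentation splits, so `F.obj X` is a retract of a projective
    -- object.
    refine ⟨fun hX => ?_, h₁ X⟩
    obtain ⟨S, rfl, hS, -, hP⟩ := h₂ X
    have := hS.epi_g
    have r : Retract S.X₃ S.X₂ :=
      ⟨Projective.factorThru (𝟙 _) S.g, S.g, Projective.factorThru_comp _ _⟩
    rw [projective_iff_hasProjectiveDimensionLT_one] at hP ⊢
    exact (r.map F).hasProjectiveDimensionLT 1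
  | succ n ih =>
    obtain ⟨S, rfl, hS, hFS, hP⟩ := h₂ X
    -- The middle term is projective in both categories, by `h₁` in the source, so both sides shift
    -- to the kernel `S.X₁`.
    rw [hS.hasProjectiveDimensionLT_X₃_iff n (h₁ _ hP), ih]
    exact (hFS.hasProjectiveDimensionLT_X₃_iff n hP).symm

/-- Dimension at most `n` is dimension less than `n + 1`. Bounds by natural numbers do not
distinguish the zero object, whose supremum is over the empty set and equals `0`, from a nonzero
projective. -/
theorem sSup_nontrivial_ext_le_iff [HasExt.{w} C] (X : C) (n : ℕ) :
    sSup {d : ℕ∞ | ∃ n : ℕ, d = n ∧ ∃ Y : C, Nontrivial (Abelian.Ext.{w} X Y n)} ≤ n ↔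
      HasProjectiveDimensionLT X (n + 1) := by
  rw [sSup_le_iff]
  constructor
  · intro h
    refine HasProjectiveDimensionLT.mk fun i hi Y e => ?_
    by_contra he
    have := h i ⟨i, rfl, Y, ⟨e, 0, he⟩⟩
    have : i ≤ n := by exact_mod_cast this
    omega
  · rintro h _ ⟨i, rfl, Y, hY⟩
    by_contra hi
    have hi : n + 1 ≤ i := by
      have : ¬ i ≤ n := by exact_mod_cast hi
      omega
    exact not_subsingleton _ (HasProjectiveDimensionLT.subsingleton X (n + 1) i hi Y)

/-- An element of `ℕ∞` is determined by its natural upper bounds. The universes `w` and `w'` are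
independent because the two cohomologies are defined with `Ext` groups in different universes. -/
theorem sSup_nontrivial_ext_eq [HasExt.{w} C] [HasExt.{w'} D] {X : C} {Z : D}
    (h : ∀ n : ℕ, HasProjectiveDimensionLT X (n + 1) ↔ HasProjectiveDimensionLT Z (n + 1)) :
    sSup {d : ℕ∞ | ∃ n : ℕ, d = n ∧ ∃ Y : C, Nontrivial (Abelian.Ext.{w} X Y n)} =
      sSup {d : ℕ∞ | ∃ n : ℕ, d = n ∧ ∃ Y : D, Nontrivial (Abelian.Ext.{w'} Z Y n)} := by
  refine eq_of_forall_ge_iff fun c => ?_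
  induction c with
  | top => simp only [le_top]
  | coe n => rw [sSup_nontrivial_ext_le_iff, sSup_nontrivial_ext_le_iff, h]

end Dimension

end HopfCD

end

theorem theorem6p1 {k A : Type u} [Field k] [IsAlgClosed k] [CharZero k] [Ring A]
    [HopfAlgebra k A] (hA : HopfCD.IsCosemisimple k A)
    (hS : ∀ a : A, HopfAlgebra.antipode k (HopfAlgebra.antipode k
      (HopfAlgebra.antipode k (HopfAlgebra.antipode k a))) = a) :
    HopfCD.cd k A = HopfCD.cdGS k A := by
  obtain ⟨h, hh⟩ := HopfCD.exists_isNormalizedIntegral hA hS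
  -- The same choice of `Ext` groups as in `GSCohomology`.
  let _ := HasExt.standard (HopfCD.YDCat k A)
  refine HopfCD.sSup_nontrivial_ext_eq (X := HopfCD.regularBimodule k A)
    (Z := HopfCD.trivialYD k A) fun n => ?_
  rw [HopfCD.hasProjectiveDimensionLT_succ_iff_of_functor (HopfCD.bimoduleFunctor k A)
    (fun P _ => HopfCD.projective_of_projective_bimoduleFunctor hh hS P)
    (fun V => ⟨_, rfl, HopfCD.YDCat.shortExact_free V, HopfCD.YDCat.shortExact_map_free V,
      inferInstanceAs (Projective ((HopfCD.bimoduleFunctor k A).obj (HopfCD.YDCat.free V)))⟩)]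
  exact ⟨fun _ => hasProjectiveDimensionLT_of_iso HopfCD.bimoduleFunctorTrivial.symm _,
    fun _ => hasProjectiveDimensionLT_of_iso HopfCD.bimoduleFunctorTrivial _⟩
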